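/- Let $\mathbb{F}_q$ be a finite field, $A=\mathbb{F}_q[T]$, $k$ a finite extension of $\mathbb{F}_q$, and $k\{\tau\}$ the ring of twisted polynomials with $\tau\alpha=\alpha^q\tau$ for $\alpha\in k$. Let $\phi:A\to k\{\tau\}$, $a\mapsto\phi_a$, be a Drinfeld module, i.e. an injective morphism of $\mathbb{F}_q$-algebras. Let $r=\deg_\tau(\phi_T)$ be its rank, let $\mathfrak{p}$ be its characteristic (the minimal polynomial over $\mathbb{F}_q$ of the degree zero coefficient of $\phi_T$), and let $\operatorname{End}(\phi)=\{u\in k\{\tau\}: u\phi_T=\phi_Tu\}$. For a monic irreducible $\mathfrak{l}\in A$ with $\mathfrak{l}\neq\mathfrak{p}$, let $A_{\mathfrak{l}}=\varprojlim_n A/\mathfrak{l}^n$ and let $T_{\mathfrak{l}}(\phi)=\varprojlim_n\phi[\mathfrak{l}^n]$ be the Tate module, where $\phi[a]\subset\overline{k}$ is the set of roots of $\phi_a(x)$ and the transition maps are given by $\phi_{\mathfrak{l}}$. Then $T_{\mathfrak{l}}(\phi)$ is a free $A_{\mathfrak{l}}$-module of rank $r$ for every monic irreducible $\mathfrak{l}\neq\mathfrak{p}$,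 and for every $v\in\operatorname{End}(\phi)$ the determinant of the $A_{\mathfrak{l}}$-linear map induced by $v$ on $T_{\mathfrak{l}}(\phi)$ is an element $\det(v)\in A$ that does not depend on $\mathfrak{l}$. For every $v\in\operatorname{End}(\phi)$ (separable or not), $$\deg_T\det(v)=\deg_\tau(v),$$ where both degrees of $0$ are $-\infty$. Moreover, let $R=\mathbb{F}_q[v,T]$ be the commutative subring of $\operatorname{End}(\phi)$ generated by $\mathbb{F}_q$, $v$ and $\phi_T$ (which plays the role of $T$). Then $R$ is an integral domain, the map $x\mapsto-\deg_T\det(x)$ (with value $+\infty$ at $x=0$) is a valuation $R\to\mathbb{Z}\cup\{+\infty\}$, and it extends to a valuation of the fraction field $\mathbb{F}_q(v,T)$ of $R$. -/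

import Mathlib

open Polynomial

noncomputable section

namespace Drinfeld

/-! ### The twisted polynomial ring `k{τ}` and its action on the algebraic closure of `k` -/

/-- A copy of `k` on which the generator of `Multiplicative ℕ` acts as `a ↦ a ^ q`, `q = #F`. -/
def Tw (F k : Type*) [Field F] [Field k] : Type _ := k

section Twisted

variable (F k : Type*) [Field F] [Fintype F] [Field k] [Algebra F k]

instance : Field (Tw F k) := inferInstanceAs (Field k)

instance : Algebra F (Tw F k) := inferInstanceAs (Algebra F k)

instance : MulSemiringAction (Multiplicative ℕ) (Tw F k) where
  smul n a := (FiniteField.frobeniusAlgHom F (Tw F k) ^ n.toAdd) a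
  one_smul _ := rfl
  mul_smul m n a := congrArg (fun f : Tw F k →ₐ[F] Tw F k => f a)
    (pow_add (FiniteField.frobeniusAlgHom F (Tw F k)) m.toAdd n.toAdd)
  smul_zero n := map_zero (FiniteField.frobeniusAlgHom F (Tw F k) ^ n.toAdd)
  smul_add n := map_add (FiniteField.frobeniusAlgHom F (Tw F k) ^ n.toAdd)
  smul_one n := map_one (FiniteField.frobeniusAlgHom F (Tw F k) ^ n.toAdd)
  smul_mul n := map_mul (FiniteField.frobeniusAlgHom F (Tw F k) ^ n.toAdd)

variable {F k} in
theorem Tw.smul_def (n : Multiplicative ℕ) (a : Tw F k) :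
    n • a = a ^ (Fintype.card F ^ n.toAdd) := by
  change ((FiniteField.frobeniusAlgHom F (Tw F k)) ^ n.toAdd) a = _
  induction n.toAdd with
  | zero => simp
  | succ m ih => rw [pow_succ', AlgHom.mul_apply, ih]; simp [pow_succ, pow_mul]

instance : SMulCommClass (Multiplicative ℕ) F (Tw F k) where
  smul_comm n c a :=
    map_smul ((FiniteField.frobeniusAlgHom F (Tw F k)) ^ n.toAdd) c a

/-- The ring `k{τ}` of twisted polynomials `∑ aᵢ τ ^ i`, with `τ a = a ^ q τ`. -/
abbrev TwistedPoly : Type _ := SkewPolynomial (Tw F k)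

variable {F k} in
theorem TwistedPoly.tau_mul_C (a : Tw F k) :
    (SkewPolynomial.X * SkewPolynomial.C a : TwistedPoly F k) =
      SkewPolynomial.C (a ^ Fintype.card F) * SkewPolynomial.X := by
  rw [SkewPolynomial.C_mul_X_eq_monomial, ← SkewPolynomial.monomial_zero_left,
    SkewPolynomial.X_mul_monomial, zero_add]
  exact congrArg _ ((Tw.smul_def _ a).trans (by simp))

variable {F k} in
/-- The degree in `τ`, with `degτ 0 = ⊥`. -/
def degτ (u : TwistedPoly F k) : WithBot ℕ := u.support.max

/-- The action of `k{τ}` on the algebraic closure of `k`: the scalars act by multiplication and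
`τ` acts as `x ↦ x ^ q`. -/
def action : TwistedPoly F k →ₐ[F] Module.End F (AlgebraicClosure k) :=
  SkewMonoidAlgebra.liftNCAlgHom
    ((Algebra.lmul F (AlgebraicClosure k)).comp
      (IsScalarTower.toAlgHom F k (AlgebraicClosure k)) : Tw F k →ₐ[F] _)
    (powersHom (Module.End F (AlgebraicClosure k))
      (FiniteField.frobeniusAlgHom F (AlgebraicClosure k)).toLinearMap)
    (by
      intro a n
      have key : ∀ (m : ℕ) (x : AlgebraicClosure k),
          ((FiniteField.frobeniusAlgHom F (AlgebraicClosure k)).toLinearMap ^ m) x =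
            x ^ (Fintype.card F ^ m) := by
        intro m x
        induction m with
        | zero => simp
        | succ m ih => rw [pow_succ', Module.End.mul_apply, ih]; simp [pow_succ, pow_mul]
      ext x
      rw [Tw.smul_def]
      have h1 : algebraMap k (AlgebraicClosure k) a ^ (Fintype.card F ^ n.toAdd) *
          ((FiniteField.frobeniusAlgHom F (AlgebraicClosure k)).toLinearMap ^ n.toAdd) x =
          ((FiniteField.frobeniusAlgHom F (AlgebraicClosure k)).toLinearMap ^ n.toAdd)
          (algebraMap k (AlgebraicClosure k) a * x) := by
        rw [key, key, mul_pow]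
      refine Eq.trans ?_ h1
      exact congrArg (· * _) (map_pow (algebraMap k (AlgebraicClosure k)) a _))

/-- The action of `u` is evaluation of the attached `q`-polynomial `∑ aᵢ x ^ (q ^ i)`. -/
theorem action_apply (u : TwistedPoly F k) (x : AlgebraicClosure k) :
    action F k u x = ∑ i ∈ u.support,
      algebraMap k (AlgebraicClosure k) (u.coeff i) * x ^ (Fintype.card F ^ i) := by
  have key : ∀ (m : ℕ) (x : AlgebraicClosure k),
      ((FiniteField.frobeniusAlgHom F (AlgebraicClosure k)).toLinearMap ^ m) x =
        x ^ (Fintype.card F ^ m) := by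
    intro m x
    induction m with
    | zero => simp
    | succ m ih => rw [pow_succ', Module.End.mul_apply, ih]; simp [pow_succ, pow_mul]
  rw [← SkewPolynomial.sum_def (p := u) (f := fun i a =>
    algebraMap k (AlgebraicClosure k) a * x ^ (Fintype.card F ^ i))]
  change (SkewMonoidAlgebra.sum u _ : Module.End F (AlgebraicClosure k)) x = _
  rw [SkewPolynomial.sum_def', SkewMonoidAlgebra.sum_def, SkewMonoidAlgebra.sum_def, Finsupp.sum,
    Finsupp.sum, LinearMap.sum_apply]
  refine Finset.sum_congr rfl fun n _ => ?_
  rw [← key]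
  rfl

end Twisted

/-! ### Tate modules -/

section Tate

variable {A : Type*} [CommRing A] (l : A) (M : Type*) [AddCommGroup M] [Module A M]

/-- The `l`-adic completion of `A`, that is, the inverse limit of the rings `A / l ^ n`. -/
abbrev Completion : Type _ := AdicCompletion (Ideal.span {l}) A

/-- The inverse limit of the torsion modules `M[l ^ n]`, with multiplication by `l` as transition
maps `M[l ^ (n + 1)] → M[l ^ n]`. -/
def tateModule : Submodule A (ℕ → M) where
  carrier := {s | ∀ n, l ^ n • s n = 0 ∧ l • s (n + 1) = s n}
  zero_mem' n := by simp
  add_mem' {s t} hs ht n := by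
    simp [smul_add, (hs n).1, (hs n).2, (ht n).1, (ht n).2]
  smul_mem' c s hs n := by
    simp [smul_comm _ c, (hs n).1, (hs n).2]

variable {l M}

theorem smul_eq_of_mk_eq {s : ℕ → M} (hs : s ∈ tateModule l M) {n : ℕ} {p p' : A}
    (h : Ideal.Quotient.mk (Ideal.span {l} ^ n) p = Ideal.Quotient.mk _ p') :
    p • s n = p' • s n := by
  rw [Ideal.Quotient.eq, Ideal.span_singleton_pow, Ideal.mem_span_singleton] at h
  obtain ⟨c, hc⟩ := h
  rw [← sub_eq_zero, ← sub_smul, hc, mul_comm, mul_smul, (hs n).1, smul_zero]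

/-- A representative in `A` of the image of `a` in `A / l ^ n`. -/
def rep (a : Completion l) (n : ℕ) : A :=
  Function.surjInv Ideal.Quotient.mk_surjective (AdicCompletion.evalₐ (Ideal.span {l}) n a)

theorem mk_rep (a : Completion l) (n : ℕ) :
    Ideal.Quotient.mk (Ideal.span {l} ^ n) (rep a n) =
      AdicCompletion.evalₐ (Ideal.span {l}) n a :=
  Function.surjInv_eq _ _

theorem mk_rep_succ (a : Completion l) (n : ℕ) :
    Ideal.Quotient.mk (Ideal.span {l} ^ n) (rep a (n + 1)) =
      Ideal.Quotient.mk (Ideal.span {l} ^ n) (rep a n) := by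
  rw [mk_rep]
  obtain ⟨f, rfl⟩ := AdicCompletion.mk_surjective _ _ a
  have h := mk_rep (AdicCompletion.mk _ _ f) (n + 1)
  rw [AdicCompletion.evalₐ_mk] at h ⊢
  rw [← AdicCompletion.Ideal.mk_eq_mk _ (Nat.le_succ n), Ideal.Quotient.eq]
  exact Ideal.pow_le_pow_right (Nat.le_succ n) (Ideal.Quotient.eq.1 h)

/-- The completion acts on the Tate module componentwise: on `M[l ^ n]` through `A / l ^ n`. -/
instance : SMul (Completion l) (tateModule l M) where
  smul a s := ⟨fun n => rep a n • s.1 n, fun n => by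
    refine ⟨?_, ?_⟩
    · rw [smul_comm, (s.2 n).1, smul_zero]
    · rw [smul_comm, (s.2 n).2, smul_eq_of_mk_eq s.2 (mk_rep_succ a n)]⟩

theorem smul_val_apply {a : Completion l} {s : tateModule l M} {n : ℕ} {p : A}
    (h : AdicCompletion.evalₐ (Ideal.span {l}) n a = Ideal.Quotient.mk _ p) :
    (a • s).1 n = p • s.1 n :=
  smul_eq_of_mk_eq s.2 ((mk_rep a n).trans h)

instance : Module (Completion l) (tateModule l M) where
  one_smul s := Subtype.ext <| funext fun n => by
    rw [smul_val_apply (p := 1) (by simp), one_smul]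
  mul_smul a b s := Subtype.ext <| funext fun n => by
    rw [smul_val_apply (p := rep a n * rep b n) (by simp [mk_rep]), mul_smul]
    rfl
  smul_zero a := Subtype.ext <| funext fun n => smul_zero (rep a n)
  smul_add a s t := Subtype.ext <| funext fun n => smul_add (rep a n) _ _
  add_smul a b s := Subtype.ext <| funext fun n => by
    rw [smul_val_apply (p := rep a n + rep b n) (by simp [mk_rep]), add_smul]
    rfl
  zero_smul s := Subtype.ext <| funext fun n => by
    rw [smul_val_apply (p := 0) (by simp), zero_smul]
    rfl

variable (l) in
/-- The map induced on Tate modules by an `A`-linear map. -/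
def tateMap {N : Type*} [AddCommGroup N] [Module A N] (f : M →ₗ[A] N) :
    tateModule l M →ₗ[Completion l] tateModule l N where
  toFun s := ⟨fun n => f (s.1 n), fun n => by
    rw [← map_smul, ← map_smul, (s.2 n).1, (s.2 n).2, map_zero]
    exact ⟨rfl, rfl⟩⟩
  map_add' s t := Subtype.ext <| funext fun n => map_add f _ _
  map_smul' a s := Subtype.ext <| funext fun n => map_smul f (rep a n) (s.1 n)

end Tate

end Drinfeld

open Drinfeld

/-- A Drinfeld module over `k`: an injective morphism of `F`-algebras `F[T] → k{τ}`. -/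
structure DrinfeldModule (F k : Type*) [Field F] [Fintype F] [Field k] [Algebra F k] where
  toAlgHom : F[X] →ₐ[F] TwistedPoly F k
  injective : Function.Injective toAlgHom

namespace DrinfeldModule

variable {F k : Type*} [Field F] [Fintype F] [Field k] [Algebra F k] (φ : DrinfeldModule F k)

/-- The rank: the degree in `τ` of `φ_T`. -/
def rank : ℕ := (degτ (φ.toAlgHom X)).unbotD 0

/-- The characteristic: the minimal polynomial over `F` of the degree zero coefficient of `φ_T`. -/
def characteristic : F[X] := minpoly F ((φ.toAlgHom X).coeff 0)

/-- The endomorphism ring: the elements of `k{τ}` that commute with `φ_T`. -/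
def End : Subalgebra F (TwistedPoly F k) := Subalgebra.centralizer F {φ.toAlgHom X}

theorem mem_End {u : TwistedPoly F k} :
    u ∈ φ.End ↔ φ.toAlgHom X * u = u * φ.toAlgHom X := by
  simp [End, Subalgebra.mem_centralizer_iff]

/-- `φ_T` as an endomorphism of `φ`. -/
def T : φ.End := ⟨φ.toAlgHom X, φ.mem_End.2 rfl⟩

theorem commute_of_mem_End {u : TwistedPoly F k} (hu : u ∈ φ.End) (a : F[X]) :
    φ.toAlgHom a * u = u * φ.toAlgHom a := by
  induction a using Polynomial.induction_on' with
  | add p q hp hq => rw [map_add, add_mul, mul_add, hp, hq]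
  | monomial n c =>
    rw [← Polynomial.C_mul_X_pow_eq_monomial, ← Polynomial.smul_eq_C_mul, map_smul, map_pow,
      smul_mul_assoc, mul_smul_comm]
    congr 1
    exact Commute.pow_left (φ.mem_End.1 hu) n

/-- The algebraic closure of `k`, as an `F[T]`-module on which `a` acts as `x ↦ φ_a(x)`. -/
def Points (_φ : DrinfeldModule F k) : Type _ := AlgebraicClosure k

instance : AddCommGroup φ.Points := inferInstanceAs (AddCommGroup (AlgebraicClosure k))

instance : Module F[X] φ.Points :=
  Module.compHom (AlgebraicClosure k) ((action F k).comp φ.toAlgHom).toRingHom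

theorem smul_points_def (a : F[X]) (x : φ.Points) : a • x = action F k (φ.toAlgHom a) x := rfl

/-- The `F[T]`-linear map on the points of `φ` given by an endomorphism. -/
def pointsMap (v : φ.End) : φ.Points →ₗ[F[X]] φ.Points where
  toFun x := action F k v.1 x
  map_add' x y := map_add (action F k v.1) x y
  map_smul' a x := by
    have h := congrArg (fun u => action F k u x) (φ.commute_of_mem_End v.2 a)
    simp only [map_mul] at h
    exact h.symm

/-- The Tate module of `φ` at `l`: the inverse limit of the `φ[l ^ n]` along `φ_l`. -/
abbrev Tate (l : F[X]) : Type _ := tateModule l φ.Points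

/-- The action of an endomorphism of `φ` on the Tate module at `l`. -/
def tateEnd (l : F[X]) (v : φ.End) : φ.Tate l →ₗ[Completion l] φ.Tate l :=
  tateMap l (φ.pointsMap v)

/-- The subring `F[v, T]` of the endomorphism ring. -/
def adjoinT (v : φ.End) : Subalgebra F φ.End := Algebra.adjoin F {v, φ.T}

instance (v : φ.End) : CommRing (φ.adjoinT v) where
  mul_comm := by
    have h : v * φ.T = φ.T * v := Subtype.ext (φ.mem_End.1 v.2).symm
    have hc : IsMulCommutative (φ.adjoinT v) := Algebra.isMulCommutative_adjoin F (by
      rintro a (rfl | rfl) b (rfl | rfl)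
      · rfl
      · exact h
      · exact h.symm
      · rfl)
    exact hc.is_comm.comm

end DrinfeldModule

/-- The negative of the degree, with value `⊤` at the zero polynomial. -/
def negDeg {F : Type*} [Field F] (a : F[X]) : WithTop ℤ :=
  open Classical in if a = 0 then ⊤ else ((-(a.natDegree : ℤ) : ℤ) : WithTop ℤ)

end

open Polynomial

set_option linter.unusedSectionVars false

noncomputable section

open Drinfeld

/-! The determinant is computed on the motive of `φ`: the ring `k{τ}` with `X` acting by right
multiplication by `φ_T`. Over `k[X]` it is free with basis `τ ^ i`, `i < r`. Let `V` be the matrix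
of right multiplication by `v`, and `s` the degree of `v ≠ 0`. The element `τ ^ i φ_T ^ t` has
degree `i + r * t`, so the degrees of the entries of `V` are bounded by `(i + s - j) / r`, and the
bound is attained in each row at `j ≡ i + s` modulo `r`. These positions form one permutation, whose
product dominates the Leibniz sum, so `det V` has degree exactly `s` (`degree_det_eq`,
`exists_motive_matrix`). Separability of `v` plays no role.

To compare `V` with the Tate module, let `g = l ^ n` and `L` the algebraic closure. The motive and
the torsion `φ[g]` are paired with values in `L[X] / g` (`pairing`). Right multiplication by `v` is
adjoint to the action of `v` on points, so `V P = P a`, with `P` the Gram matrix and `a` a matrix of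
`v` on `φ[g]`. `P` is invertible: a combination in its kernel vanishes on all `q ^ (r * deg g)`
points of `φ[g]`, more than its degree as a `q`-polynomial (`eq_zero_of_combine_eq_zero`). Hence
`det V ≡ det a` modulo `g` (`mk_det_eq`). A large `n` shows that `det V` has coefficients in `F`;
all `n` together identify it with the determinant on the Tate module (`exists_det`).

Freeness of rank `r` follows from counting the zeros of the separable `φ_l` and from divisibility of
the points (`exists_tateBasis`). The valuation axioms are those of the degree in `τ`. -/

namespace Drinfeld

/-! ### Twisted polynomials as `q`-polynomials: degree, separability, zeros. -/

section QPoly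

variable {F k : Type*} [Field F] [Fintype F] [Field k] [Algebra F k]

/-- Two polynomials over `k` that agree on the algebraic closure are equal. -/
theorem eq_of_aeval_eq {p p' : k[X]}
    (h : ∀ x : AlgebraicClosure k, aeval x p = aeval x p') : p = p' := by
  apply Polynomial.map_injective _ (algebraMap k (AlgebraicClosure k)).injective
  apply Polynomial.funext
  intro x
  rw [eval_map_algebraMap, eval_map_algebraMap, h]

/-- The identification of the twisted copy of `k` with `k`. -/
def Tw.equiv : Tw F k ≃ₐ[F] k := (AlgEquiv.refl : k ≃ₐ[F] k)

/-- The coefficients of a twisted polynomial, as elements of `k`. -/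
def cf (u : TwistedPoly F k) (i : ℕ) : k := Tw.equiv (u.coeff i)

theorem cf_eq_zero {u : TwistedPoly F k} {i : ℕ} : cf u i = 0 ↔ u.coeff i = 0 :=
  map_eq_zero_iff _ Tw.equiv.injective

theorem mem_support_iff_cf {u : TwistedPoly F k} {i : ℕ} : i ∈ u.support ↔ cf u i ≠ 0 :=
  SkewPolynomial.mem_support_iff.trans (not_congr cf_eq_zero.symm)

theorem cf_add (u v : TwistedPoly F k) (i : ℕ) : cf (u + v) i = cf u i + cf v i :=
  (congrArg Tw.equiv (SkewPolynomial.coeff_add u v i)).trans (map_add Tw.equiv _ _)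

theorem cf_sub (u v : TwistedPoly F k) (i : ℕ) : cf (u - v) i = cf u i - cf v i :=
  (congrArg Tw.equiv (SkewPolynomial.coeff_sub u v i)).trans (map_sub Tw.equiv _ _)

theorem action_eq_sum_cf (u : TwistedPoly F k) (x : AlgebraicClosure k) :
    action F k u x = ∑ i ∈ u.support,
      algebraMap k (AlgebraicClosure k) (cf u i) * x ^ (Fintype.card F ^ i) :=
  action_apply F k u x

/-- The `q`-polynomial `∑ aᵢ X ^ (q ^ i)` attached to `∑ aᵢ τ ^ i`. -/
def toPoly (u : TwistedPoly F k) : k[X] :=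
  ∑ i ∈ u.support, monomial (Fintype.card F ^ i) (cf u i)

theorem aeval_toPoly (u : TwistedPoly F k) (x : AlgebraicClosure k) :
    aeval x (toPoly u) = action F k u x := by
  rw [action_eq_sum_cf, toPoly, map_sum]
  refine Finset.sum_congr rfl fun i _ => ?_
  rw [aeval_monomial]

theorem toPoly_mul (u v : TwistedPoly F k) : toPoly (u * v) = (toPoly u).comp (toPoly v) :=
  eq_of_aeval_eq fun x => by rw [aeval_comp]; simp [aeval_toPoly]

theorem one_lt_card : 1 < Fintype.card F := Fintype.one_lt_card

theorem coeff_toPoly (u : TwistedPoly F k) (i : ℕ) :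
    (toPoly u).coeff (Fintype.card F ^ i) = cf u i := by
  classical
  rw [toPoly, finsetSum_coeff]
  simp only [coeff_monomial, Nat.pow_right_inj (one_lt_card (F := F))]
  rw [Finset.sum_ite_eq' u.support i]
  split_ifs with h
  · rfl
  · exact (not_not.1 (mt mem_support_iff_cf.2 h)).symm

theorem coeff_toPoly_of_ne (u : TwistedPoly F k) {n : ℕ} (h : ∀ i, n ≠ Fintype.card F ^ i) :
    (toPoly u).coeff n = 0 := by
  rw [toPoly, finsetSum_coeff]
  exact Finset.sum_eq_zero fun i _ => by rw [coeff_monomial, if_neg (h i).symm]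

@[simp] theorem toPoly_zero : toPoly (0 : TwistedPoly F k) = 0 := by simp [toPoly]

theorem degτ_eq_bot {u : TwistedPoly F k} : degτ u = ⊥ ↔ u = 0 := by
  rw [degτ, Finset.max_eq_bot, SkewPolynomial.support_eq_empty]

theorem degτ_lt_iff {u : TwistedPoly F k} {n : ℕ} :
    degτ u < n ↔ ∀ m, n ≤ m → cf u m = 0 := by
  rw [degτ, Finset.max, Finset.sup_lt_iff (show (⊥ : WithBot ℕ) < n from WithBot.bot_lt_coe n)]
  constructor
  · intro h m hm
    by_contra hne
    have := h m (mem_support_iff_cf.2 hne)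
    exact absurd (WithBot.coe_lt_coe.1 this) (not_lt.2 hm)
  · intro h m hm
    refine WithBot.coe_lt_coe.2 (not_le.1 fun hle => ?_)
    exact mem_support_iff_cf.1 hm (h m hle)

theorem cf_ne_zero_of_degτ_eq {u : TwistedPoly F k} {n : ℕ} (h : degτ u = n) :
    cf u n ≠ 0 := mem_support_iff_cf.1 (Finset.mem_of_max h)

theorem degτ_eq_iff {u : TwistedPoly F k} {n : ℕ} :
    degτ u = n ↔ (toPoly u).degree = (Fintype.card F ^ n : ℕ) := by
  have key : ∀ n : ℕ, degτ u = n → (toPoly u).degree = (Fintype.card F ^ n : ℕ) := by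
    intro n h
    apply le_antisymm
    · rw [degree_le_iff_coeff_zero]
      intro m hm
      by_cases hm' : ∃ i, m = Fintype.card F ^ i
      · obtain ⟨i, rfl⟩ := hm'
        rw [coeff_toPoly]
        have hni : n < i :=
          (Nat.pow_lt_pow_iff_right (one_lt_card (F := F))).1 (WithBot.coe_lt_coe.1 hm)
        have : degτ u < ((n + 1 : ℕ) : WithBot ℕ) := by
          rw [h]; exact WithBot.coe_lt_coe.2 n.lt_succ_self
        exact degτ_lt_iff.1 this i hni
      · exact coeff_toPoly_of_ne u fun i hi => hm' ⟨i, hi⟩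
    · apply le_degree_of_ne_zero
      rw [coeff_toPoly]
      exact cf_ne_zero_of_degτ_eq h
  refine ⟨key n, fun h => ?_⟩
  rcases hu : degτ u with _ | m
  · rw [degτ_eq_bot.1 hu, toPoly_zero, degree_zero] at h
    exact absurd h (WithBot.bot_ne_coe)
  · have h' := key m hu
    rw [h] at h'
    have := Nat.pow_right_injective (one_lt_card (F := F)) (WithBot.coe_injective h')
    rw [this]; rfl

/-- Products in `k{τ}` are compositions of `q`-polynomials, and composition multiplies degrees: `q ^
m * q ^ n = q ^ (m + n)`. -/
theorem degτ_mul {u v : TwistedPoly F k} : degτ (u * v) = degτ u + degτ v := by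
  rcases hu : degτ u with _ | m
  · rw [degτ_eq_bot.1 hu, zero_mul]
    exact degτ_eq_bot.2 rfl
  rcases hv : degτ v with _ | n
  · rw [degτ_eq_bot.1 hv, mul_zero]
    exact degτ_eq_bot.2 rfl
  have hm := degτ_eq_iff.1 hu
  have hn := degτ_eq_iff.1 hv
  have hu0 : toPoly u ≠ 0 := fun h => by
    rw [h, degree_zero] at hm; exact WithBot.bot_ne_coe hm
  refine (degτ_eq_iff (n := m + n)).2 ?_
  have hc : natDegree (toPoly (u * v)) = Fintype.card F ^ (m + n) := by
    rw [toPoly_mul, natDegree_comp, natDegree_eq_of_degree_eq_some hm,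
      natDegree_eq_of_degree_eq_some hn, pow_add]
  rw [← hc, degree_eq_natDegree]
  intro h0
  rw [h0, natDegree_zero] at hc
  exact (pow_pos (one_lt_card (F := F)).le _).ne hc

theorem degτ_add_le (u v : TwistedPoly F k) : degτ (u + v) ≤ max (degτ u) (degτ v) := by
  rw [degτ, degτ, degτ, ← Finset.max_union]
  exact Finset.max_mono SkewPolynomial.support_add

instance : NoZeroDivisors (TwistedPoly F k) where
  eq_zero_or_eq_zero_of_mul_eq_zero {u v} h := by
    rw [← degτ_eq_bot, degτ_mul, WithBot.add_eq_bot] at h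
    exact h.imp degτ_eq_bot.1 degτ_eq_bot.1

/-- The exponents `q ^ i` with `i > 0` vanish in `k`, so only the linear term contributes. A nonzero
linear coefficient therefore forces separability. -/
theorem derivative_toPoly (u : TwistedPoly F k) :
    derivative (toPoly u) = C (cf u 0) := by
  have hq : (Fintype.card F : k) = 0 := by
    rw [← map_natCast (algebraMap F k), FiniteField.cast_card_eq_zero, map_zero]
  rw [toPoly, derivative_sum]
  simp only [derivative_monomial]
  have : ∀ i ∈ u.support, monomial (Fintype.card F ^ i - 1)
      ((cf u i) * ((Fintype.card F ^ i : ℕ) : k)) =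
      if i = 0 then C (cf u 0) else 0 := by
    intro i _
    split_ifs with h
    · subst h
      rw [pow_zero, Nat.sub_self, Nat.cast_one, mul_one, monomial_zero_left]
    · rw [Nat.cast_pow, hq, zero_pow h, mul_zero, map_zero]
  rw [Finset.sum_congr rfl this, Finset.sum_ite_eq']
  split_ifs with h
  · rfl
  · rw [not_not.1 (mt mem_support_iff_cf.2 h), map_zero]

/-- This is the chain rule for polynomials with constant derivative. -/
theorem cf_zero_mul (u v : TwistedPoly F k) : cf (u * v) 0 = cf u 0 * cf v 0 := by
  apply C_injective (R := k)
  rw [← derivative_toPoly, toPoly_mul, derivative_comp, derivative_toPoly, derivative_toPoly,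
    C_comp, ← C_mul, mul_comm]

theorem separable_toPoly {u : TwistedPoly F k} (h : cf u 0 ≠ 0) : (toPoly u).Separable := by
  rw [separable_def, derivative_toPoly]
  exact ⟨0, C (cf u 0)⁻¹, by rw [zero_mul, zero_add, ← C_mul, inv_mul_cancel₀ h, C_1]⟩

/-- The number of zeros of a separable twisted polynomial. -/
theorem card_ker_action {u : TwistedPoly F k} {n : ℕ} (h : cf u 0 ≠ 0) (hn : degτ u = n) :
    Nat.card {x : AlgebraicClosure k // action F k u x = 0} = Fintype.card F ^ n := by
  have hu : toPoly u ≠ 0 := (separable_toPoly h).ne_zero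
  have hc := card_rootSet_eq_natDegree (K := AlgebraicClosure k) (separable_toPoly h)
    (IsAlgClosed.splits _)
  rw [natDegree_eq_of_degree_eq_some (degτ_eq_iff.1 hn), ← Nat.card_eq_fintype_card] at hc
  rw [← hc]
  refine Nat.card_congr (Equiv.subtypeEquivRight fun x => ?_)
  rw [mem_rootSet_of_ne hu, aeval_toPoly]

/-- Applied to `φ_l`, this gives the divisibility that lifts torsion points to the Tate module. -/
theorem action_surjective {u : TwistedPoly F k} (hu : u ≠ 0) :
    Function.Surjective (action F k u) := by
  intro y
  rcases hn : degτ u with _ | n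
  · exact absurd (degτ_eq_bot.1 hn) hu
  have hd := degτ_eq_iff.1 hn
  have hpos : (0 : WithBot ℕ) < (toPoly u).degree := by
    rw [hd]; exact WithBot.coe_lt_coe.2 (pow_pos (one_lt_card (F := F)).le _)
  obtain ⟨x, hx⟩ := IsAlgClosed.exists_root
    ((toPoly u).map (algebraMap k (AlgebraicClosure k)) - C y) (by
      rw [degree_sub_C (by rwa [degree_map]), degree_map]
      exact hpos.ne')
  refine ⟨x, ?_⟩
  rw [← aeval_toPoly, ← eval_map_algebraMap]
  simpa [sub_eq_zero] using hx

end QPoly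

end Drinfeld

namespace Drinfeld

/-! ### The degree of a determinant with weighted entries. -/

section Det

variable {K : Type*} [Field K]

/-- The permutation `i ↦ i + s` of the residues modulo `r`. -/
def shiftPerm (r s : ℕ) : Equiv.Perm (Fin r) :=
  Equiv.ofBijective (fun i => ⟨(i + s) % r, Nat.mod_lt _ i.pos⟩) <| by
    rw [← Finite.injective_iff_bijective]
    intro i j h
    have h' : (i + s) % r = (j + s) % r := congrArg Fin.val h
    have h2 : (i : ℕ) ≡ j [MOD r] := Nat.ModEq.add_right_cancel' s h'
    exact Fin.ext (Nat.ModEq.eq_of_lt_of_lt h2 i.2 j.2)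

theorem shiftPerm_apply (r s : ℕ) (i : Fin r) : (shiftPerm r s i : ℕ) = (i + s) % r := rfl

/-- If the entries of a square matrix of size `r` have degrees bounded by `(i + s - j) / r`, and the
entries for which this is an integer attain the bound, then the determinant has degree `s`. -/
theorem degree_det_eq {r s : ℕ} (hr : 0 < r) (V : Matrix (Fin r) (Fin r) K[X])
    (hV : ∀ i j t, (V i j).coeff t ≠ 0 → (j : ℕ) + r * t ≤ i + s)
    (hV' : ∀ i, (V i (shiftPerm r s i)).coeff ((i + s) / r) ≠ 0) :
    V.det.degree = s := by
  -- Summing the row bounds `σ i + r * deg ≤ i + s` removes the permutation and leaves `r * ∑ deg ≤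
  -- r * s`.
  have hsum : ∀ σ : Equiv.Perm (Fin r),
      ∑ i : Fin r, ((i : ℕ) + s) = ∑ i : Fin r, (σ i : ℕ) + r * s := by
    intro σ
    rw [Finset.sum_add_distrib, Equiv.sum_comp σ (fun i : Fin r => (i : ℕ))]
    simp
  have hle : ∀ i j, V i j ≠ 0 → (j : ℕ) + r * (V i j).natDegree ≤ i + s := fun i j h =>
    hV i j _ (by simpa using h)
  have hlt : ∀ σ : Equiv.Perm (Fin r), σ ≠ shiftPerm r s →
      (∏ i, V i (σ i)).degree < s := by
    intro σ hσ
    by_cases h0 : ∃ i, V i (σ i) = 0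
    · obtain ⟨i, hi⟩ := h0
      rw [Finset.prod_eq_zero (Finset.mem_univ i) hi, degree_zero]
      exact WithBot.bot_lt_coe _
    push Not at h0
    rw [degree_eq_natDegree (Finset.prod_ne_zero_iff.2 fun i _ => h0 i),
      natDegree_prod _ _ fun i _ => h0 i]
    refine WithBot.coe_lt_coe.2 ?_
    obtain ⟨i₀, hi₀⟩ : ∃ i, σ i ≠ shiftPerm r s i := by
      by_contra hcon
      push Not at hcon
      exact hσ (Equiv.ext hcon)
    -- Equality in row `i` would force `σ i` to be the residue of `i + s`, so any other permutation
    -- loses degree in some row.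
    have h1 : ∑ i, ((σ i : ℕ) + r * (V i (σ i)).natDegree) < ∑ i : Fin r, ((i : ℕ) + s) := by
      refine Finset.sum_lt_sum (fun i _ => hle i _ (h0 i)) ⟨i₀, Finset.mem_univ _, ?_⟩
      refine lt_of_le_of_ne (hle i₀ _ (h0 i₀)) fun heq => hi₀ (Fin.ext ?_)
      rw [shiftPerm_apply, ← heq, Nat.add_mul_mod_self_left, Nat.mod_eq_of_lt (σ i₀).2]
    rw [hsum σ, Finset.sum_add_distrib, ← Finset.mul_sum] at h1
    exact Nat.lt_of_mul_lt_mul_left (Nat.lt_of_add_lt_add_left h1)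
  have heq : (∏ i, V i (shiftPerm r s i)).degree = s := by
    have h0 : ∀ i, V i (shiftPerm r s i) ≠ 0 := fun i h => hV' i (by rw [h, coeff_zero])
    rw [degree_eq_natDegree (Finset.prod_ne_zero_iff.2 fun i _ => h0 i),
      natDegree_prod _ _ fun i _ => h0 i]
    have h1 : ∀ i, ((shiftPerm r s i : ℕ) + r * (V i (shiftPerm r s i)).natDegree) = i + s := by
      intro i
      refine le_antisymm (hle i _ (h0 i)) ?_
      calc (i : ℕ) + s = (i + s) % r + r * ((i + s) / r) := (Nat.mod_add_div _ _).symm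
        _ ≤ _ := by
          rw [shiftPerm_apply]
          gcongr
          exact le_natDegree_of_ne_zero (hV' i)
    have h2 := hsum (shiftPerm r s)
    rw [← Finset.sum_congr rfl fun i _ => h1 i, Finset.sum_add_distrib, ← Finset.mul_sum] at h2
    rw [Nat.eq_of_mul_eq_mul_left hr (Nat.add_left_cancel h2)]
  have hsign : ∀ (σ : Equiv.Perm (Fin r)) (p : K[X]),
      (Equiv.Perm.sign σ • p).degree = p.degree := by
    intro σ p
    rcases Int.units_eq_one_or (Equiv.Perm.sign σ) with h | h <;> simp [h]
  -- The transpose turns the factors `V (σ i) i` of the Leibniz formula into `V i (σ i)`.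
  rw [← Matrix.det_transpose, Matrix.det_apply,
    ← Finset.add_sum_erase _ _ (Finset.mem_univ (shiftPerm r s)),
    degree_add_eq_left_of_degree_lt, hsign]
  · exact heq
  · rw [hsign]
    change _ < (∏ i, V i (shiftPerm r s i)).degree
    rw [heq]
    refine (degree_sum_le _ _).trans_lt ?_
    rw [Finset.sup_lt_iff (show (⊥ : WithBot ℕ) < (s : WithBot ℕ) from WithBot.bot_lt_coe s)]
    intro σ hσ
    rw [hsign]
    exact hlt σ (Finset.ne_of_mem_erase hσ)

end Det

/-! ### The motive: `k{τ}` over `k[Θ]`. -/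

section Basis

variable {F k : Type*} [Field F] [Fintype F] [Field k] [Algebra F k]

/-- The constants of the twisted polynomial ring. -/
def cst (c : k) : TwistedPoly F k := SkewPolynomial.C (Tw.equiv.symm c)

theorem toPoly_cst (c : k) : toPoly (cst c : TwistedPoly F k) = C c * X := by
  rcases eq_or_ne c 0 with rfl | h
  · rw [cst, map_zero, SkewPolynomial.C_0, toPoly_zero, C_0, zero_mul]
  · rw [toPoly, cst, SkewPolynomial.support_C ((map_ne_zero_iff _ Tw.equiv.symm.injective).2 h),
      Finset.sum_singleton, pow_zero, cf, SkewPolynomial.coeff_C_zero, AlgEquiv.apply_symm_apply,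
      C_mul_X_eq_monomial]

theorem cf_cst_mul (c : k) (u : TwistedPoly F k) (n : ℕ) : cf (cst c * u) n = c * cf u n := by
  rw [← coeff_toPoly, toPoly_mul, toPoly_cst, mul_comp, C_comp, X_comp, coeff_C_mul, coeff_toPoly]

theorem action_cst_mul (c : k) (u : TwistedPoly F k) (x : AlgebraicClosure k) :
    action F k (cst c * u) x = algebraMap k (AlgebraicClosure k) c * action F k u x := by
  rw [← aeval_toPoly, toPoly_mul, toPoly_cst, mul_comp, C_comp, X_comp, map_mul, aeval_C,
    aeval_toPoly]

theorem degτ_X : degτ (SkewPolynomial.X : TwistedPoly F k) = (1 : ℕ) := by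
  rw [degτ, SkewPolynomial.support_X, Finset.max_singleton]
  rfl

theorem degτ_one : degτ (1 : TwistedPoly F k) = (0 : ℕ) := by
  rw [← SkewPolynomial.C_1, degτ, SkewPolynomial.support_C one_ne_zero, Finset.max_singleton]
  rfl

theorem degτ_pow {u : TwistedPoly F k} {n : ℕ} (h : degτ u = n) (m : ℕ) :
    degτ (u ^ m) = (n * m : ℕ) := by
  induction m with
  | zero => rw [pow_zero, degτ_one, mul_zero]
  | succ m ih => rw [pow_succ, degτ_mul, ih, h, mul_add, mul_one]; rfl

/-- For `Θ` of degree `r` the elements `τ ^ i Θ ^ t` with `i < r` form a basis of `k{τ}`. -/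
def bas (Θ : TwistedPoly F k) (i t : ℕ) : TwistedPoly F k := SkewPolynomial.X ^ i * Θ ^ t

theorem degτ_bas {Θ : TwistedPoly F k} {r : ℕ} (h : degτ Θ = r) (i t : ℕ) :
    degτ (bas Θ i t) = (i + r * t : ℕ) := by
  rw [bas, degτ_mul, degτ_pow degτ_X, degτ_pow h, one_mul]; rfl

/-- Since `j = j % r + r * (j / r)`, there is exactly one basis element in each degree `j`, and
leading terms are cancelled one by one. -/
theorem exists_eq_sum_bas {Θ : TwistedPoly F k} {r : ℕ} (hΘ : degτ Θ = r) (n : ℕ) :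
    ∀ u : TwistedPoly F k, degτ u < n → ∃ c : ℕ → k,
      u = ∑ j ∈ Finset.range n, cst (c j) * bas Θ (j % r) (j / r) := by
  induction n with
  | zero =>
    intro u hu
    refine ⟨0, ?_⟩
    rw [Finset.range_zero, Finset.sum_empty, ← degτ_eq_bot]
    exact (WithBot.lt_coe_bot).1 hu
  | succ n ih =>
    intro u hu
    have hb : degτ (bas Θ (n % r) (n / r)) = n := by rw [degτ_bas hΘ, Nat.mod_add_div]
    set b := bas Θ (n % r) (n / r) with hbdef
    set a : k := cf u n / cf b n
    obtain ⟨c, hc⟩ := ih (u - cst a * b) (degτ_lt_iff.2 fun m hm => by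
      rw [cf_sub, cf_cst_mul]
      rcases Nat.eq_or_lt_of_le hm with rfl | hlt
      · rw [div_mul_cancel₀ _ (cf_ne_zero_of_degτ_eq hb), sub_self]
      · rw [degτ_lt_iff.1 hu m hlt, degτ_lt_iff.1
          (hb.trans_lt (WithBot.coe_lt_coe.2 n.lt_succ_self)) m hlt, mul_zero, sub_self])
    refine ⟨Function.update c n a, ?_⟩
    rw [Finset.sum_range_succ, Function.update_self, ← hbdef, ← sub_eq_iff_eq_add, hc]
    refine Finset.sum_congr rfl fun j hj => ?_
    rw [Function.update_of_ne (Finset.mem_range.1 hj).ne]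

/-- This forces the top coordinate of an element of degree `n` to be nonzero. -/
theorem degτ_sum_bas_lt {Θ : TwistedPoly F k} {r : ℕ} (hΘ : degτ Θ = r) (n : ℕ) (c : ℕ → k) :
    degτ (∑ j ∈ Finset.range n, cst (c j) * bas Θ (j % r) (j / r)) < n := by
  induction n with
  | zero =>
    rw [Finset.range_zero, Finset.sum_empty, degτ_eq_bot.2 rfl]
    exact WithBot.bot_lt_coe _
  | succ n ih =>
    rw [Finset.sum_range_succ]
    refine (degτ_add_le _ _).trans_lt (max_lt (ih.trans ?_) ?_)
    · exact WithBot.coe_lt_coe.2 n.lt_succ_self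
    · refine degτ_lt_iff.2 fun m hm => ?_
      rw [cf_cst_mul, degτ_lt_iff.1 _ m hm, mul_zero]
      rw [degτ_bas hΘ, Nat.mod_add_div]
      exact WithBot.coe_lt_coe.2 n.lt_succ_self

/-- The coordinates of a twisted polynomial of degree `n` with respect to the basis `τ ^ i` of
`k{τ}` over `k[Θ]`. -/
theorem exists_coordinates {Θ : TwistedPoly F k} {r : ℕ} (hr : 0 < r) (hΘ : degτ Θ = r) {n : ℕ}
    {u : TwistedPoly F k} (hu : degτ u = n) : ∃ w : Fin r → k[X],
      u = ∑ i, (w i).sum (fun t c => cst c * bas Θ i t) ∧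
      (∀ i t, (w i).coeff t ≠ 0 → (i : ℕ) + r * t ≤ n) ∧
      (w ⟨n % r, Nat.mod_lt _ hr⟩).coeff (n / r) ≠ 0 := by
  obtain ⟨c, hc⟩ := exists_eq_sum_bas hΘ (n + 1) u
    (hu.trans_lt (WithBot.coe_lt_coe.2 n.lt_succ_self))
  have hcn : c n ≠ 0 := by
    intro h0
    rw [Finset.sum_range_succ, h0, cst, map_zero, SkewPolynomial.C_0, zero_mul, add_zero] at hc
    have := degτ_sum_bas_lt hΘ n c
    rw [← hc, hu] at this
    exact lt_irrefl _ this
  have hmonomial : ∀ {a : k} {t : ℕ} {i : ℕ}, (monomial t a).sum (fun t c => cst c * bas Θ i t) =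
      cst a * bas Θ i t := by
    intro a t i
    exact sum_monomial_index a _ (by rw [cst, map_zero, SkewPolynomial.C_0, zero_mul])
  -- The expansion is regrouped by residues modulo `r`: the term `j` goes to coordinate `j % r`, in
  -- degree `j / r`.
  let w : Fin r → k[X] := fun i =>
    ∑ j ∈ Finset.range (n + 1) with (⟨j % r, Nat.mod_lt _ hr⟩ : Fin r) = i, monomial (j / r) (c j)
  have hw : ∀ i t, (w i).coeff t = if (i : ℕ) + r * t ≤ n then c (i + r * t) else 0 := by
    intro i t
    have hdm : ∀ j : ℕ, ((⟨j % r, Nat.mod_lt _ hr⟩ : Fin r) = i ∧ j / r = t) ↔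
        j = i + r * t := by
      intro j
      constructor
      · rintro ⟨rfl, rfl⟩
        exact (Nat.mod_add_div _ _).symm
      · rintro rfl
        refine ⟨Fin.ext ?_, ?_⟩
        · simp [Nat.mod_eq_of_lt i.2]
        · rw [Nat.add_mul_div_left _ _ hr, Nat.div_eq_of_lt i.2, zero_add]
    simp only [w, finsetSum_coeff, coeff_monomial]
    rw [Finset.sum_filter]
    simp only [← ite_and, hdm]
    rw [Finset.sum_ite_eq']
    simp
  refine ⟨w, ?_, ?_, ?_⟩
  · have hadd : ∀ (i : ℕ) (s : Finset ℕ),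
        (∑ j ∈ s, monomial (j / r) (c j)).sum (fun t c => cst c * bas Θ i t) =
        ∑ j ∈ s, cst (c j) * bas Θ i (j / r) := by
      intro i s
      have h0 : ∀ t, (cst (0 : k) * bas Θ i t) = 0 := fun t => by
        rw [cst, map_zero, SkewPolynomial.C_0, zero_mul]
      induction s using Finset.induction_on with
      | empty => simp
      | insert j s hj ih =>
        rw [Finset.sum_insert hj, Finset.sum_insert hj, sum_add_index, ih, hmonomial]
        · exact h0
        · intro t a b
          rw [cst, map_add, SkewPolynomial.C_add, add_mul]; rfl
    rw [hc, ← Finset.sum_fiberwise (Finset.range (n + 1))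
      (fun j => (⟨j % r, Nat.mod_lt _ hr⟩ : Fin r))]
    refine Finset.sum_congr rfl fun i _ => ?_
    rw [hadd]
    refine Finset.sum_congr rfl fun j hj => ?_
    rw [← (Finset.mem_filter.1 hj).2]
  · intro i t h
    rw [hw] at h
    by_contra hcon
    exact h (if_neg hcon)
  · rw [hw, if_pos]
    · simpa [Nat.mod_add_div] using hcn
    · simp [Nat.mod_add_div]

/-- The matrix of the right multiplication by `v` on `k{τ}` over `k[Θ]`; its determinant has the
degree of `v`. -/
theorem exists_motive_matrix {Θ : TwistedPoly F k} {r : ℕ} (hr : 0 < r) (hΘ : degτ Θ = r)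
    (v : TwistedPoly F k) : ∃ V : Matrix (Fin r) (Fin r) k[X],
      (∀ i : Fin r, SkewPolynomial.X ^ (i : ℕ) * v =
        ∑ j, (V i j).sum (fun t c => cst c * bas Θ j t)) ∧
      V.det.degree = degτ v := by
  rcases hv : degτ v with _ | s
  · refine ⟨0, fun i => ?_, ?_⟩
    · rw [degτ_eq_bot.1 hv, mul_zero]; simp
    -- Positive size matters: the empty determinant would be `1`, not `0`.
    · have : Nonempty (Fin r) := ⟨⟨0, hr⟩⟩
      rw [Matrix.det_zero, degree_zero]; rfl
  · have hd : ∀ i : Fin r, degτ (SkewPolynomial.X ^ (i : ℕ) * v) = ((i + s : ℕ) : WithBot ℕ) := by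
      intro i
      rw [degτ_mul, degτ_pow degτ_X, hv, one_mul]; rfl
    -- Row `i` holds the coordinates of `τ ^ i * v`, of degree `i + s`; their bounds are the
    -- hypotheses of `degree_det_eq`.
    choose V h1 h2 h3 using fun i => exists_coordinates hr hΘ (hd i)
    exact ⟨V, h1, degree_det_eq hr V h2 h3⟩

end Basis

end Drinfeld

namespace Drinfeld

/-! ### A pairing with values modulo `g`. -/

section Pairing

variable {F L M : Type*} [Field F] [Field L] [Algebra F L] [AddCommGroup M] [Module F[X] M]

theorem coeff_divX_iterate (g : F[X]) (n i : ℕ) : (divX^[n] g).coeff i = g.coeff (i + n) := by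
  induction n generalizing i with
  | zero => rfl
  | succ n ih => rw [Function.iterate_succ_apply', coeff_divX, ih]; congr 1; ring

/-- The pairing `∑ f(gᵢ x) X ^ i` attached to the quotients `gᵢ` of `g` by `X ^ (i + 1)`, that is,
to `(g(X) - g(Y)) / (X - Y) = ∑ gᵢ(Y) X ^ i`. -/
def pairing (g : F[X]) (f : M →+ L) (x : M) : L[X] :=
  ∑ i ∈ Finset.range (g.natDegree + 1), monomial i (f (divX^[i + 1] g • x))

theorem coeff_pairing (g : F[X]) (f : M →+ L) (x : M) (i : ℕ) :
    (pairing g f x).coeff i = f (divX^[i + 1] g • x) := by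
  rw [pairing, finsetSum_coeff]
  simp only [coeff_monomial]
  rw [Finset.sum_ite_eq']
  split_ifs with h
  · rfl
  · have h0 : divX^[i + 1] g = 0 := by
      ext n
      rw [coeff_divX_iterate, coeff_zero]
      exact coeff_eq_zero_of_natDegree_lt (by rw [Finset.mem_range] at h; omega)
    rw [h0, zero_smul, map_zero]

theorem pairing_sum {ι : Type*} (g : F[X]) {f : M →+ L} {s : Finset ι} {c : ι → L}
    {f' : ι → M →+ L} (h : ∀ y, f y = ∑ i ∈ s, c i * f' i y) (x : M) :
    pairing g f x = ∑ i ∈ s, C (c i) * pairing g (f' i) x := by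
  ext n
  rw [coeff_pairing, h, finsetSum_coeff]
  exact Finset.sum_congr rfl fun i _ => by rw [coeff_C_mul, coeff_pairing]

theorem pairing_add (g : F[X]) (f : M →+ L) (x y : M) :
    pairing g f (x + y) = pairing g f x + pairing g f y := by
  ext n
  rw [coeff_add, coeff_pairing, coeff_pairing, coeff_pairing, smul_add, map_add]

theorem pairing_C_smul (g : F[X]) {f : M →+ L}
    (hf : ∀ (c : F) (x : M), f (C c • x) = algebraMap F L c * f x) (c : F) (x : M) :
    pairing g f (C c • x) = C (algebraMap F L c) * pairing g f x := by
  ext n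
  rw [coeff_pairing, coeff_C_mul, coeff_pairing, smul_comm, hf]

/-- The recursion `divX^[n + 1] g * X = divX^[n] g - C (g.coeff n)` shifts the coefficients; its
correction terms add up to a multiple of `g`. The torsion condition removes the quotient of index
`0`, which is `g` itself. -/
theorem pairing_X_smul (g : F[X]) {f : M →+ L}
    (hf : ∀ (c : F) (x : M), f (C c • x) = algebraMap F L c * f x) {x : M} (hx : g • x = 0) :
    pairing g f ((X : F[X]) • x) =
      X * pairing g f x - g.map (algebraMap F L) * C (f x) := by
  have hstep : ∀ n, f (divX^[n + 1] g • (X : F[X]) • x) =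
      f (divX^[n] g • x) - algebraMap F L (g.coeff n) * f x := by
    intro n
    have h : divX^[n + 1] g * X = divX^[n] g - C (g.coeff n) := by
      rw [eq_sub_iff_add_eq, Function.iterate_succ_apply']
      have := divX_mul_X_add (divX^[n] g)
      rwa [coeff_divX_iterate, zero_add] at this
    rw [smul_smul, h, sub_smul, map_sub, hf]
  ext n
  rw [coeff_pairing, hstep, coeff_sub, coeff_mul_C, coeff_map]
  congr 1
  cases n with
  | zero => rw [Function.iterate_zero_apply, hx, map_zero, coeff_X_mul_zero]
  | succ n => rw [coeff_X_mul, coeff_pairing]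

/-- Modulo `g`, the pairing is linear over the polynomial ring on the `g`-torsion. -/
theorem mk_pairing_smul (g : F[X]) {f : M →+ L}
    (hf : ∀ (c : F) (x : M), f (C c • x) = algebraMap F L c * f x) (a : F[X]) :
    ∀ {x : M}, g • x = 0 → AdjoinRoot.mk (g.map (algebraMap F L)) (pairing g f (a • x)) =
      AdjoinRoot.mk (g.map (algebraMap F L)) (a.map (algebraMap F L)) *
        AdjoinRoot.mk (g.map (algebraMap F L)) (pairing g f x) := by
  have hX : ∀ {x : M}, g • x = 0 → AdjoinRoot.mk (g.map (algebraMap F L))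
      (pairing g f ((X : F[X]) • x)) = AdjoinRoot.mk (g.map (algebraMap F L)) X *
        AdjoinRoot.mk (g.map (algebraMap F L)) (pairing g f x) := by
    intro x hx
    rw [pairing_X_smul g hf hx, map_sub, map_mul, map_mul, AdjoinRoot.mk_self, zero_mul, sub_zero]
  induction a using Polynomial.induction_on with
  | C c => intro x _; rw [pairing_C_smul g hf, map_mul, map_C]
  | add p q hp hq =>
    intro x hx
    rw [add_smul, pairing_add, map_add, hp hx, hq hx, Polynomial.map_add, map_add, add_mul]
  | monomial n c ih =>
    intro x hx
    have hx' : g • (X : F[X]) • x = 0 := by rw [smul_comm, hx, smul_zero]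
    rw [pow_succ, ← mul_assoc, mul_smul, ih hx', hX hx, ← mul_assoc, ← map_mul]
    congr 2
    simp only [Polynomial.map_mul, Polynomial.map_pow, map_X, map_C]

theorem mk_pairing_sum (g : F[X]) {ι : Type*} (s : Finset ι) {f : M →+ L}
    (hf : ∀ (c : F) (x : M), f (C c • x) = algebraMap F L c * f x) (a : ι → F[X]) {x : ι → M}
    (hx : ∀ i, g • x i = 0) :
    AdjoinRoot.mk (g.map (algebraMap F L)) (pairing g f (∑ i ∈ s, a i • x i)) =
      ∑ i ∈ s, AdjoinRoot.mk (g.map (algebraMap F L)) ((a i).map (algebraMap F L)) *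
        AdjoinRoot.mk (g.map (algebraMap F L)) (pairing g f (x i)) := by
  classical
  induction s using Finset.induction_on with
  | empty =>
    rw [Finset.sum_empty, Finset.sum_empty, show pairing g f (0 : M) = 0 by
      ext n; rw [coeff_pairing, smul_zero, map_zero, coeff_zero], map_zero]
  | insert i s hi ih =>
    rw [Finset.sum_insert hi, Finset.sum_insert hi, pairing_add, map_add, ih,
      mk_pairing_smul g hf _ (hx i)]

/-- The pairing is perfect: `f` is determined on `x` by its pairings modulo `g`. -/
theorem apply_eq_zero_of_mk_pairing {g : F[X]} (hg : g.Monic) (hd : g.natDegree ≠ 0) {f : M →+ L}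
    {x : M} (h : AdjoinRoot.mk (g.map (algebraMap F L)) (pairing g f x) = 0) : f x = 0 := by
  have hiter : ∀ n, g.natDegree ≤ n → divX^[n] g = C (g.coeff n) := by
    intro n hn
    ext i
    rw [coeff_divX_iterate, coeff_C]
    split_ifs with hi
    · rw [hi, zero_add]
    · exact coeff_eq_zero_of_natDegree_lt (by omega)
  -- The pairing has degree below that of `g`, so vanishing modulo `g` means vanishing.
  have h0 : pairing g f x = 0 := by
    refine eq_zero_of_dvd_of_degree_lt (AdjoinRoot.mk_eq_zero.1 h) ?_
    rw [degree_map, degree_eq_natDegree hg.ne_zero, degree_lt_iff_coeff_zero]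
    intro n hn
    rw [coeff_pairing, hiter _ (by omega), coeff_eq_zero_of_natDegree_lt (by omega), C_0,
      zero_smul, map_zero]
  -- For monic `g` of degree `d + 1` the quotient `divX^[d + 1] g` is `1`, so the coefficient of `X
  -- ^ d` is `f x`.
  obtain ⟨d, hd'⟩ := Nat.exists_eq_succ_of_ne_zero hd
  have := coeff_pairing g f x d
  rwa [h0, coeff_zero, hiter _ hd'.le, ← hd', hg.coeff_natDegree, C_1,
    one_smul, eq_comm] at this

end Pairing

end Drinfeld

/-! ### Duality between the motive and the torsion points. -/

namespace DrinfeldModule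

variable {F k : Type*} [Field F] [Fintype F] [Field k] [Algebra F k] (φ : DrinfeldModule F k)

/-- The action of a twisted polynomial on the points of `φ`. -/
def act (u : TwistedPoly F k) : φ.Points →+ AlgebraicClosure k := (action F k u).toAddMonoidHom

theorem act_apply (u : TwistedPoly F k) (x : φ.Points) : φ.act u x = action F k u x := rfl

theorem act_sum {ι : Type*} (s : Finset ι) (u : ι → TwistedPoly F k) (x : φ.Points) :
    φ.act (∑ i ∈ s, u i) x = ∑ i ∈ s, φ.act (u i) x := by
  rw [act_apply, map_sum]
  exact LinearMap.sum_apply _ _ _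

theorem act_mul_toAlgHom (u : TwistedPoly F k) (a : F[X]) (x : φ.Points) :
    φ.act (u * φ.toAlgHom a) x = φ.act u (a • x) := by
  rw [act_apply, map_mul]; rfl

theorem C_smul_points (c : F) (x : φ.Points) :
    (C c : F[X]) • x = (c • (show AlgebraicClosure k from x) : AlgebraicClosure k) := by
  rw [smul_points_def, ← algebraMap_eq, AlgHom.commutes, AlgHom.commutes]
  rfl

theorem act_C_smul (u : TwistedPoly F k) (c : F) (x : φ.Points) :
    φ.act u ((C c : F[X]) • x) = algebraMap F (AlgebraicClosure k) c * φ.act u x := by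
  rw [C_smul_points, ← Algebra.smul_def]
  exact map_smul (action F k u) c _

/-- Right multiplication by `φ_T` moves to the point as the action of `X`, and comes out of the
pairing as a factor: the pairing is linear over `k[X]` on the motive side too. -/
theorem mk_pairing_act_bas {g : F[X]} (i t : ℕ) {x : φ.Points} (hx : g • x = 0) :
    AdjoinRoot.mk (g.map (algebraMap F (AlgebraicClosure k)))
      (pairing g (φ.act (bas (φ.toAlgHom X) i t)) x) =
    AdjoinRoot.mk (g.map (algebraMap F (AlgebraicClosure k))) X ^ t *
      AdjoinRoot.mk (g.map (algebraMap F (AlgebraicClosure k)))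
        (pairing g (φ.act (SkewPolynomial.X ^ i)) x) := by
  have : pairing g (φ.act (bas (φ.toAlgHom X) i t)) x =
      pairing g (φ.act (SkewPolynomial.X ^ i)) ((X ^ t : F[X]) • x) := by
    ext n
    rw [coeff_pairing, coeff_pairing, bas, ← map_pow, act_mul_toAlgHom, smul_comm]
  rw [this, mk_pairing_smul g (φ.act_C_smul _) _ hx, Polynomial.map_pow, map_X, map_pow]

/-- The additive map `∑ wᵢₜ τ ^ i φ_T ^ t` on the points of `φ`, for `wᵢ = ∑ wᵢₜ X ^ t`. -/
def combine {r : ℕ} (w : Fin r → (AlgebraicClosure k)[X]) : φ.Points →+ AlgebraicClosure k :=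
  ∑ p ∈ Finset.univ.sigma fun i => (w i).support,
    (AddMonoidHom.mulLeft ((w p.1).coeff p.2)).comp (φ.act (bas (φ.toAlgHom X) p.1 p.2))

theorem combine_apply {r : ℕ} (w : Fin r → (AlgebraicClosure k)[X]) (x : φ.Points) :
    φ.combine w x = ∑ p ∈ Finset.univ.sigma fun i => (w i).support,
      (w p.1).coeff p.2 * φ.act (bas (φ.toAlgHom X) p.1 p.2) x := by
  rw [combine, AddMonoidHom.finsetSum_apply]; rfl

theorem combine_C_smul {r : ℕ} (w : Fin r → (AlgebraicClosure k)[X]) (c : F) (x : φ.Points) :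
    φ.combine w ((C c : F[X]) • x) = algebraMap F (AlgebraicClosure k) c * φ.combine w x := by
  rw [combine_apply, combine_apply, Finset.mul_sum]
  exact Finset.sum_congr rfl fun p _ => by rw [act_C_smul]; ring

theorem mk_pairing_combine {g : F[X]} {r : ℕ} (w : Fin r → (AlgebraicClosure k)[X])
    {x : φ.Points} (hx : g • x = 0) :
    AdjoinRoot.mk (g.map (algebraMap F (AlgebraicClosure k))) (pairing g (φ.combine w) x) =
    ∑ i, AdjoinRoot.mk (g.map (algebraMap F (AlgebraicClosure k))) (w i) *
      AdjoinRoot.mk (g.map (algebraMap F (AlgebraicClosure k)))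
        (pairing g (φ.act (SkewPolynomial.X ^ (i : ℕ))) x) := by
  rw [pairing_sum g (φ.combine_apply w), map_sum, Finset.sum_sigma]
  refine Finset.sum_congr rfl fun i _ => ?_
  conv_rhs => rw [(w i).as_sum_support_C_mul_X_pow, map_sum, Finset.sum_mul]
  refine Finset.sum_congr rfl fun t _ => ?_
  rw [map_mul, mk_pairing_act_bas φ i t hx, map_mul, map_pow, mul_assoc]

/-- A combination that vanishes at more points than its degree allows is zero. -/
theorem eq_zero_of_combine_eq_zero {g : F[X]} {r : ℕ} (hr : degτ (φ.toAlgHom X) = r)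
    (hcard : Nat.card {x : φ.Points // g • x = 0} = Fintype.card F ^ (r * g.natDegree))
    {w : Fin r → (AlgebraicClosure k)[X]} (hw : ∀ i, (w i).degree < g.natDegree)
    (h : ∀ x : φ.Points, g • x = 0 → φ.combine w x = 0) : w = 0 := by
  have hbd : ∀ i : Fin r, ∀ t, t ∈ (w i).support → (i : ℕ) + r * t < r * g.natDegree := by
    intro i t ht
    have h1 : t < g.natDegree := by
      by_contra hcon
      exact mem_support_iff.1 ht ((degree_lt_iff_coeff_zero _ _).1 (hw i) t (not_lt.1 hcon))
    calc (i : ℕ) + r * t < r + r * t := by gcongr; exact i.2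
      _ = r * (t + 1) := by ring
      _ ≤ _ := Nat.mul_le_mul_left r h1
  let S := Finset.univ.sigma fun i => (w i).support
  let P : (Σ _ : Fin r, ℕ) → (AlgebraicClosure k)[X] := fun p =>
    C ((w p.1).coeff p.2) * (toPoly (bas (φ.toAlgHom X) p.1 p.2)).map (algebraMap k _)
  have hdeg : ∀ p ∈ S, (P p).degree = (Fintype.card F ^ ((p.1 : ℕ) + r * p.2) : ℕ) := by
    intro p hp
    rw [degree_C_mul (mem_support_iff.1 (Finset.mem_sigma.1 hp).2), degree_map,
      ← degτ_eq_iff, degτ_bas hr]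
  -- Distinct pairs `(i, t)` with `i < r` give distinct `i + r * t`, so leading terms cannot cancel
  -- and a zero sum has no terms.
  have hsup : (∑ p ∈ S, P p).degree = S.sup fun p => (P p).degree := by
    refine degree_sum_eq_of_disjoint P S ?_
    rintro ⟨i, t⟩ ⟨hp, -⟩ ⟨j, s⟩ ⟨hp', -⟩ hne heq
    refine hne ?_
    simp only [Function.comp_apply, hdeg _ hp, hdeg _ hp'] at heq
    have h2 := Nat.pow_right_injective (one_lt_card (F := F)) (WithBot.coe_injective heq)
    have hij : i = j := Fin.ext <| by
      have := congrArg (· % r) h2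
      simpa [Nat.mod_eq_of_lt i.2, Nat.mod_eq_of_lt j.2] using this
    subst hij
    have : t = s := Nat.eq_of_mul_eq_mul_left i.pos (Nat.add_left_cancel h2)
    rw [this]
  have heval : ∀ x : φ.Points, (∑ p ∈ S, P p).eval (show AlgebraicClosure k from x) =
      φ.combine w x := by
    intro x
    rw [combine_apply, eval_finsetSum]
    refine Finset.sum_congr rfl fun p _ => ?_
    rw [eval_mul, eval_C, eval_map_algebraMap, aeval_toPoly]
    rfl
  have hzero : ∑ p ∈ S, P p = 0 := by
    by_contra hne
    have hle : Nat.card {x : φ.Points // g • x = 0} ≤ (∑ p ∈ S, P p).natDegree := by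
      classical
      have hfin : Finite {x : φ.Points // g • x = 0} := Nat.finite_of_card_ne_zero (by
        rw [hcard]; exact (pow_pos (one_lt_card (F := F)).le _).ne')
      have hinj : Function.Injective (fun x : {x : φ.Points // g • x = 0} =>
          (⟨x.1, Multiset.mem_toFinset.2 ((mem_roots hne).2
            ((heval x.1).trans (h x.1 x.2)))⟩ : (∑ p ∈ S, P p).roots.toFinset)) :=
        fun x y hxy => by
          have hval := congrArg Subtype.val hxy
          exact Subtype.ext hval
      refine (Nat.card_le_card_of_injective _ hinj).trans ?_
      rw [Nat.card_eq_fintype_card, Fintype.card_coe]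
      exact (Multiset.toFinset_card_le _).trans (card_roots' _)
    rw [hcard] at hle
    have hlt : (∑ p ∈ S, P p).degree < (Fintype.card F ^ (r * g.natDegree) : ℕ) := by
      rw [hsup]
      refine (Finset.sup_lt_iff (WithBot.bot_lt_coe _)).2 ?_
      intro p hp
      rw [hdeg p hp]
      exact WithBot.coe_lt_coe.2
        (Nat.pow_lt_pow_right one_lt_card (hbd p.1 p.2 (Finset.mem_sigma.1 hp).2))
    rw [degree_eq_natDegree hne] at hlt
    exact absurd hle (not_le.2 (WithBot.coe_lt_coe.1 hlt))
  rw [hzero, degree_zero] at hsup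
  funext i
  rw [Pi.zero_apply, ← support_eq_empty, Finset.eq_empty_iff_forall_notMem]
  intro t ht
  have hp : (⟨i, t⟩ : Σ _ : Fin r, ℕ) ∈ S := Finset.mem_sigma.2 ⟨Finset.mem_univ _, ht⟩
  have := Finset.le_sup (f := fun p => (P p).degree) hp
  rw [← hsup, le_bot_iff, hdeg _ hp] at this
  exact WithBot.coe_ne_bot this

/-- The determinant of `v` on the `g`-torsion agrees modulo `g` with its determinant on `k{τ}`. -/
theorem mk_det_eq {g : F[X]} (hg : g.Monic) (hd : g.natDegree ≠ 0) {r : ℕ}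
    (hr : degτ (φ.toAlgHom X) = r)
    (hcard : Nat.card {x : φ.Points // g • x = 0} = Fintype.card F ^ (r * g.natDegree))
    {x : Fin r → φ.Points} (hx : ∀ j, g • x j = 0)
    (hgen : ∀ y : φ.Points, g • y = 0 → ∃ a : Fin r → F[X], y = ∑ j, a j • x j)
    (v : φ.End) {V : Matrix (Fin r) (Fin r) k[X]}
    (hV : ∀ i : Fin r, SkewPolynomial.X ^ (i : ℕ) * (v : TwistedPoly F k) =
      ∑ j, (V i j).sum (fun t c => cst c * bas (φ.toAlgHom X) j t))
    {a : Matrix (Fin r) (Fin r) F[X]} (ha : ∀ j, φ.pointsMap v (x j) = ∑ h, a h j • x h) :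
    g.map (algebraMap F (AlgebraicClosure k)) ∣
      V.det.map (algebraMap k (AlgebraicClosure k)) -
        a.det.map (algebraMap F (AlgebraicClosure k)) := by
  set L := AlgebraicClosure k
  set G := g.map (algebraMap F L) with hG
  have hGm : G.Monic := hg.map _
  let f₁ : k[X] →+* AdjoinRoot G := (AdjoinRoot.mk G).comp (mapRingHom (algebraMap k L))
  let f₂ : F[X] →+* AdjoinRoot G := (AdjoinRoot.mk G).comp (mapRingHom (algebraMap F L))
  let P : Matrix (Fin r) (Fin r) (AdjoinRoot G) := Matrix.of fun i j =>
    AdjoinRoot.mk G (pairing g (φ.act (SkewPolynomial.X ^ (i : ℕ))) (x j))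
  -- Over the field `L` the map `w ↦ w P` is an endomorphism of a finite-dimensional space, so
  -- injectivity is enough. Representatives of degree below `deg g` make the count of zeros
  -- applicable.
  have hP : IsUnit P := by
    rw [← Matrix.vecMul_surjective_iff_isUnit]
    have hfin : Module.Finite L (AdjoinRoot G) := hGm.finite_adjoinRoot
    let T : (Fin r → AdjoinRoot G) →ₗ[L] (Fin r → AdjoinRoot G) :=
      (Matrix.vecMulLinear P).restrictScalars L
    have hT : Function.Injective T := by
      rw [injective_iff_map_eq_zero]
      intro w hw
      have hrep : ∀ i, ∃ W : L[X], W.degree < g.natDegree ∧ AdjoinRoot.mk G W = w i := by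
        intro i
        obtain ⟨W, hW⟩ := AdjoinRoot.mk_surjective (w i)
        refine ⟨W %ₘ G, ?_, ?_⟩
        · rw [← degree_eq_natDegree hg.ne_zero, ← degree_map g (algebraMap F L)]
          exact degree_modByMonic_lt _ hGm
        · rw [← hW]
          exact AdjoinRoot.mk_eq_mk.2 (by
            rw [modByMonic_eq_sub_mul_div, sub_sub_cancel_left]
            exact (Dvd.intro _ rfl).neg_right)
      choose W hW1 hW2 using hrep
      have hpair : ∀ j, AdjoinRoot.mk G (pairing g (φ.combine W) (x j)) = 0 := by
        intro j
        refine (mk_pairing_combine φ W (hx j)).trans (Eq.trans ?_ (congrFun hw j))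
        exact Finset.sum_congr rfl fun i _ => congrArg (· * P i j) (hW2 i)
      have hW0 : W = 0 := by
        refine φ.eq_zero_of_combine_eq_zero hr hcard hW1 fun y hy => ?_
        obtain ⟨b, rfl⟩ := hgen y hy
        refine apply_eq_zero_of_mk_pairing hg hd ?_
        rw [mk_pairing_sum g _ (φ.combine_C_smul W) b hx]
        exact Finset.sum_eq_zero fun j _ => by rw [hpair, mul_zero]
      funext i
      rw [← hW2, hW0]
      simp
    exact LinearMap.injective_iff_surjective.1 hT
  -- Both sides pair `τ ^ i * v` with `x j`: on the left `v` is expanded in the motive, on the right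
  -- it is moved to the point.
  have hcomm : f₁.mapMatrix V * P = P * f₂.mapMatrix a := by
    ext i j
    have h1 : AdjoinRoot.mk G (pairing g
        (φ.act (SkewPolynomial.X ^ (i : ℕ) * (v : TwistedPoly F k))) (x j)) =
        ∑ h, f₁ (V i h) * P h j := by
      have hc : φ.act (SkewPolynomial.X ^ (i : ℕ) * (v : TwistedPoly F k)) =
          φ.combine (fun h => (V i h).map (algebraMap k L)) := by
        ext y
        rw [combine_apply, hV, act_sum, Finset.sum_sigma]
        refine Finset.sum_congr rfl fun h _ => ?_
        rw [support_map_of_injective _ (algebraMap k L).injective, Polynomial.sum, act_sum]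
        refine Finset.sum_congr rfl fun t _ => ?_
        rw [coeff_map]
        exact action_cst_mul _ _ y
      rw [hc, mk_pairing_combine φ _ (hx j)]
      rfl
    have h2 : AdjoinRoot.mk G (pairing g
        (φ.act (SkewPolynomial.X ^ (i : ℕ) * (v : TwistedPoly F k))) (x j)) =
        ∑ h, P i h * f₂ (a h j) := by
      have hc : pairing g (φ.act (SkewPolynomial.X ^ (i : ℕ) * (v : TwistedPoly F k))) (x j) =
          pairing g (φ.act (SkewPolynomial.X ^ (i : ℕ))) (φ.pointsMap v (x j)) := by
        ext n
        rw [coeff_pairing, coeff_pairing, ← map_smul, act_apply, map_mul]; rfl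
      rw [hc, ha, mk_pairing_sum g _ (φ.act_C_smul _) _ hx]
      exact Finset.sum_congr rfl fun h _ => mul_comm _ _
    rw [Matrix.mul_apply, Matrix.mul_apply]
    exact h1.symm.trans h2
  have hdet := congrArg Matrix.det hcomm
  rw [Matrix.det_mul, Matrix.det_mul, mul_comm P.det] at hdet
  have hdet' := ((Matrix.isUnit_iff_isUnit_det P).1 hP).mul_right_cancel hdet
  rw [← RingHom.map_det, ← RingHom.map_det] at hdet'
  exact AdjoinRoot.mk_eq_mk.1 hdet'

end DrinfeldModule

namespace Drinfeld

/-! ### Bases of Tate modules from bases of the `l`-torsion. -/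

section TateBasis

variable {A : Type*} [CommRing A] {l : A} {M : Type*} [AddCommGroup M] [Module A M]

theorem tateModule_sum_apply {ι : Type*} (s : Finset ι) (f : ι → tateModule l M) (n : ℕ) :
    (∑ i ∈ s, f i).1 n = ∑ i ∈ s, (f i).1 n := by
  rw [AddSubmonoidClass.coe_finsetSum, Finset.sum_apply]

theorem exists_tate_of_torsion (hdiv : ∀ x : M, ∃ y, l • y = x) {x : M} (hx : l • x = 0) :
    ∃ s : tateModule l M, s.1 1 = x := by
  choose d hd using hdiv
  have hz : ∀ n, l ^ (n + 1) • d^[n] x = 0 := by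
    intro n
    induction n with
    | zero => simpa using hx
    | succ n ih => rw [Function.iterate_succ_apply', pow_succ, mul_smul, hd, ih]
  -- Level `0` must carry `0`, and `x` sits at level `1`, hence the shift of the index.
  refine ⟨⟨fun n => n.casesOn 0 fun m => d^[m] x, fun n => ?_⟩, rfl⟩
  cases n with
  | zero => exact ⟨smul_zero _, hx⟩
  | succ n => exact ⟨hz n, (congrArg (l • ·) (Function.iterate_succ_apply' d n x)).trans (hd _)⟩

theorem pow_smul_tate_succ (s : tateModule l M) (n : ℕ) : l ^ n • s.1 (n + 1) = s.1 1 := by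
  induction n with
  | zero => rw [pow_zero, one_smul]
  | succ n ih => rw [pow_succ, mul_smul, (s.2 (n + 1)).2, ih]

variable {ι : Type*} [Fintype ι]

/-- Multiplication by `l ^ n` brings a relation from level `n + 1` to level `1`, so each coefficient
is divisible by `l`; the quotients satisfy a relation at level `n`. -/
theorem dvd_of_sum_smul_eq_zero {e : ι → tateModule l M}
    (hind : ∀ a : ι → A, ∑ i, a i • (e i).1 1 = 0 → ∀ i, l ∣ a i) (n : ℕ) :
    ∀ a : ι → A, ∑ i, a i • (e i).1 n = 0 → ∀ i, l ^ n ∣ a i := by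
  induction n with
  | zero => intro a _ i; rw [pow_zero]; exact one_dvd _
  | succ n ih =>
    intro a ha i
    have h1 := congrArg (l ^ n • ·) ha
    simp only [Finset.smul_sum, smul_comm (l ^ n) (a _), pow_smul_tate_succ, smul_zero] at h1
    choose b hb using hind a h1
    have h2 : ∑ i, b i • (e i).1 n = 0 := by
      rw [← ha]
      exact Finset.sum_congr rfl fun i _ => by
        rw [hb i, mul_comm, mul_smul, ((e i).2 n).2]
    rw [hb i, pow_succ']
    exact mul_dvd_mul_left l (ih b h2 i)

/-- The element `l ^ n • x` is `l`-torsion; subtracting the combination with its coefficients at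
level `n + 1` leaves an element killed by `l ^ n`. -/
theorem exists_eq_sum_smul {e : ι → tateModule l M}
    (hspan : ∀ x : M, l • x = 0 → ∃ a : ι → A, x = ∑ i, a i • (e i).1 1) (n : ℕ) :
    ∀ x : M, l ^ n • x = 0 → ∃ a : ι → A, x = ∑ i, a i • (e i).1 n := by
  induction n with
  | zero =>
    intro x hx
    rw [pow_zero, one_smul] at hx
    exact ⟨0, by simp [hx]⟩
  | succ n ih =>
    intro x hx
    obtain ⟨a, ha⟩ := hspan (l ^ n • x) (by rw [smul_smul, ← pow_succ', hx])
    obtain ⟨b, hb⟩ := ih (x - ∑ i, a i • (e i).1 (n + 1)) (by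
      rw [smul_sub, ha, Finset.smul_sum, sub_eq_zero]
      exact Finset.sum_congr rfl fun i _ => by rw [smul_comm, pow_smul_tate_succ])
    refine ⟨fun i => a i + b i * l, ?_⟩
    rw [sub_eq_iff_eq_add'] at hb
    rw [hb, ← Finset.sum_add_distrib]
    exact Finset.sum_congr rfl fun i _ => by rw [add_smul, mul_smul, ((e i).2 n).2]

theorem evalₐ_eq_zero_of_dvd {c : Completion l} {n : ℕ} (h : l ^ n ∣ rep c n) :
    AdicCompletion.evalₐ (Ideal.span {l}) n c = 0 := by
  rw [← mk_rep, Ideal.Quotient.eq_zero_iff_mem, Ideal.span_singleton_pow]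
  exact Ideal.mem_span_singleton.2 h

/-- If `M` is `l`-divisible and `M[l]` is free over `A / l`, then the Tate module is free, and a
basis of it generates the torsion at each level. -/
theorem exists_tate_basis (hdiv : ∀ x : M, ∃ y, l • y = x) {e₀ : ι → M} (he : ∀ i, l • e₀ i = 0)
    (hind : ∀ a : ι → A, ∑ i, a i • e₀ i = 0 → ∀ i, l ∣ a i)
    (hspan : ∀ x : M, l • x = 0 → ∃ a : ι → A, x = ∑ i, a i • e₀ i) :
    ∃ b : Module.Basis ι (Completion l) (tateModule l M), ∀ n, ∀ x : M, l ^ n • x = 0 →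
      ∃ a : ι → A, x = ∑ i, a i • (b i).1 n := by
  choose e he' using fun i => exists_tate_of_torsion hdiv (he i)
  have hind' := dvd_of_sum_smul_eq_zero (e := e) (by simpa only [he'] using hind)
  have hspan' := exists_eq_sum_smul (e := e) (by simpa only [he'] using hspan)
  have hli : LinearIndependent (Completion l) e := by
    rw [Fintype.linearIndependent_iff]
    intro c hc i
    refine AdicCompletion.ext_evalₐ fun n => ?_
    rw [map_zero]
    refine evalₐ_eq_zero_of_dvd (hind' n (fun i => rep (c i) n) ?_ i)
    have := congrArg (fun s : tateModule l M => s.1 n) hc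
    rw [tateModule_sum_apply] at this
    exact this
  have hsp : ⊤ ≤ Submodule.span (Completion l) (Set.range e) := by
    rintro s -
    choose a ha using fun n => hspan' n (s.1 n) (s.2 n).1
    -- By independence at level `n`, coefficients of consecutive levels agree modulo `l ^ n`, so
    -- they define elements of the completion.
    have hcauchy : ∀ i n, a n i ≡ a (n + 1) i
        [SMOD (Ideal.span {l} ^ n • ⊤ : Submodule A A)] := by
      intro i n
      rw [SModEq.comm, SModEq.sub_mem, smul_eq_mul, Ideal.mul_top, Ideal.span_singleton_pow,
        Ideal.mem_span_singleton]
      refine hind' n (fun i => a (n + 1) i - a n i) ?_ i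
      simp only [sub_smul, Finset.sum_sub_distrib]
      rw [← ha n, ← (s.2 n).2, ha (n + 1), Finset.smul_sum, sub_eq_zero]
      exact Finset.sum_congr rfl fun j _ => by rw [smul_comm l, ((e j).2 n).2]
    let c : ι → Completion l := fun i =>
      AdicCompletion.mk _ _ (AdicCompletion.AdicCauchySequence.mk _ _ (fun n => a n i) (hcauchy i))
    have hs : s = ∑ i, c i • e i := by
      refine Subtype.ext (funext fun n => ?_)
      rw [tateModule_sum_apply, ha n]
      refine Finset.sum_congr rfl fun i _ => (smul_val_apply ?_).symm
      rw [AdicCompletion.evalₐ_mk]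
      rfl
    rw [hs]
    exact Submodule.sum_mem _ fun i _ => Submodule.smul_mem _ _ (Submodule.subset_span ⟨i, rfl⟩)
  refine ⟨Module.Basis.mk hli hsp, fun n x hx => ?_⟩
  simpa only [Module.Basis.mk_apply] using hspan' n x hx

end TateBasis

/-! ### Degrees of `φ_a`, torsion of `φ`, and comparison of determinants. -/

section Scalars

variable {F k : Type*} [Field F] [Fintype F] [Field k] [Algebra F k]

theorem toPoly_algebraMap (c : F) :
    toPoly (algebraMap F (TwistedPoly F k) c) = C (algebraMap F k c) * X :=
  eq_of_aeval_eq fun x => by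
    rw [aeval_toPoly, AlgHom.commutes, Module.algebraMap_end_apply, map_mul, aeval_C, aeval_X,
      Algebra.smul_def, ← IsScalarTower.algebraMap_apply]

theorem cf_algebraMap (c : F) : cf (algebraMap F (TwistedPoly F k) c) 0 = algebraMap F k c := by
  rw [← coeff_toPoly, toPoly_algebraMap, pow_zero, coeff_C_mul, coeff_X_one, mul_one]

theorem degτ_algebraMap_lt (c : F) : degτ (algebraMap F (TwistedPoly F k) c) < (1 : ℕ) := by
  refine degτ_lt_iff.2 fun m hm => ?_
  rw [← coeff_toPoly, toPoly_algebraMap, coeff_C_mul, coeff_X_of_ne_one, mul_zero]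
  exact (Nat.one_lt_pow (by omega) one_lt_card).ne'

end Scalars

end Drinfeld

namespace DrinfeldModule

variable {F k : Type*} [Field F] [Fintype F] [Field k] [Algebra F k] (φ : DrinfeldModule F k)

theorem toAlgHom_X_ne_zero : φ.toAlgHom X ≠ 0 := fun h =>
  X_ne_zero (φ.injective (h.trans (map_zero φ.toAlgHom).symm))

theorem degτ_toAlgHom_X : degτ (φ.toAlgHom X) = φ.rank := by
  rw [rank]
  rcases h : degτ (φ.toAlgHom X) with _ | n
  · exact absurd (degτ_eq_bot.1 h) φ.toAlgHom_X_ne_zero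
  · rfl

/-- In rank zero all powers of `φ_T` would be constants in the finite field `k`, so two of them
would coincide, against injectivity. Finiteness of `k` enters only here. -/
theorem rank_pos [Finite k] : 0 < φ.rank := by
  rw [Nat.pos_iff_ne_zero]
  intro h0
  have hpow : ∀ n, degτ (φ.toAlgHom X ^ n) < (1 : ℕ) := by
    intro n
    rw [degτ_pow φ.degτ_toAlgHom_X, h0, zero_mul]
    exact WithBot.coe_lt_coe.2 zero_lt_one
  refine not_injective_infinite_finite (fun n : ℕ => cf (φ.toAlgHom X ^ n) 0) fun m n hmn => ?_
  have h1 : φ.toAlgHom X ^ m = φ.toAlgHom X ^ n := by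
    rw [← sub_eq_zero, ← degτ_eq_bot, ← WithBot.lt_coe_bot]
    refine degτ_lt_iff.2 fun i _ => ?_
    rw [cf_sub]
    rcases Nat.eq_zero_or_pos i with rfl | hi
    · exact sub_eq_zero.2 hmn
    · rw [degτ_lt_iff.1 (hpow m) i hi, degτ_lt_iff.1 (hpow n) i hi, sub_self]
  rw [← map_pow, ← map_pow] at h1
  have h2 := congrArg natDegree (φ.injective h1)
  rwa [natDegree_X_pow, natDegree_X_pow] at h2

/-- In `a = a.divX * X + C (a.coeff 0)` the constant cannot affect the leading term, because the
rank is positive. -/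
theorem degτ_toAlgHom [Finite k] {a : F[X]} (ha : a ≠ 0) :
    degτ (φ.toAlgHom a) = (φ.rank * a.natDegree : ℕ) := by
  have key : ∀ n, ∀ a : F[X], a.natDegree = n → a ≠ 0 →
      degτ (φ.toAlgHom a) = (φ.rank * n : ℕ) := by
    intro n
    induction n with
    | zero =>
      intro a hn ha
      rw [natDegree_eq_zero] at hn
      obtain ⟨c, rfl⟩ := hn
      have hlt := degτ_algebraMap_lt (k := k) c
      rw [← algebraMap_eq, AlgHom.commutes]
      rcases h : degτ (algebraMap F (TwistedPoly F k) c) with _ | m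
      · have h' := degτ_eq_bot.1 h
        rw [← AlgHom.commutes φ.toAlgHom] at h'
        exact absurd (φ.injective (h'.trans (map_zero φ.toAlgHom).symm)) ha
      · rw [h] at hlt
        have : m < 1 := WithBot.coe_lt_coe.1 hlt
        rw [Nat.lt_one_iff.1 this, mul_zero]; rfl
    | succ n ih =>
      intro a hn _
      have hd : a.divX.natDegree = n := by rw [natDegree_divX_eq_natDegree_tsub_one, hn]; rfl
      have hd0 : a.divX ≠ 0 := by
        rw [Ne, divX_eq_zero_iff]
        intro h
        rw [h, natDegree_C] at hn
        exact Nat.succ_ne_zero n hn.symm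
      have hmain : degτ (φ.toAlgHom (a.divX * X)) = (φ.rank * (n + 1) : ℕ) := by
        rw [map_mul, degτ_mul, ih _ hd hd0, degτ_toAlgHom_X]; rfl
      have hpos : 1 ≤ φ.rank * (n + 1) := Nat.mul_pos φ.rank_pos n.succ_pos
      have hC : degτ (φ.toAlgHom (C (a.coeff 0))) < (1 : ℕ) := by
        rw [← algebraMap_eq, AlgHom.commutes]
        exact degτ_algebraMap_lt _
      have hC' : ∀ i, 1 ≤ i → cf (φ.toAlgHom (C (a.coeff 0))) i = 0 := degτ_lt_iff.1 hC
      rw [← divX_mul_X_add a, map_add]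
      refine le_antisymm ((degτ_add_le _ _).trans (max_le hmain.le ?_)) ?_
      · exact hC.le.trans (WithBot.coe_le_coe.2 hpos)
      · refine Finset.le_max (a := φ.rank * (n + 1)) (mem_support_iff_cf.2 ?_)
        rw [cf_add, hC' _ hpos, add_zero]
        exact cf_ne_zero_of_degτ_eq hmain
  exact key _ a rfl ha

theorem cf_toAlgHom_zero (a : F[X]) :
    cf (φ.toAlgHom a) 0 = aeval (cf (φ.toAlgHom X) 0) a := by
  induction a using Polynomial.induction_on with
  | C c => rw [aeval_C, ← algebraMap_eq, AlgHom.commutes, cf_algebraMap]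
  | add p q hp hq => rw [map_add, cf_add, hp, hq, map_add]
  | monomial n c ih =>
    rw [pow_succ, ← mul_assoc, map_mul, cf_zero_mul, ih, map_mul _ _ X, aeval_X]

/-- The constant coefficient of `φ_l` is the value of `l` at that of `φ_T`. A monic irreducible `l`
vanishing there is the minimal polynomial. Thus `φ_l` is separable away from the characteristic. -/
theorem cf_toAlgHom_zero_ne_zero {l : F[X]} (hm : l.Monic) (hl : Irreducible l)
    (hne : l ≠ φ.characteristic) : cf (φ.toAlgHom l) 0 ≠ 0 := by
  rw [cf_toAlgHom_zero]
  intro h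
  refine hne ((minpoly.eq_of_irreducible_of_monic hl h hm).trans ?_)
  exact minpoly.algEquiv_eq Tw.equiv _

theorem card_torsion [Finite k] {g : F[X]} (hg : g ≠ 0) (h : cf (φ.toAlgHom g) 0 ≠ 0) :
    Nat.card {x : φ.Points // g • x = 0} = Fintype.card F ^ (φ.rank * g.natDegree) :=
  card_ker_action h (φ.degτ_toAlgHom hg)

/-- The `l`-torsion is a vector space over the field `F[X] / l` of `q ^ deg l` elements, so its
cardinality `q ^ (r * deg l)` determines its dimension. -/
theorem exists_torsion_basis [Finite k] {l : F[X]} (hl : Irreducible l)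
    (h : cf (φ.toAlgHom l) 0 ≠ 0) : ∃ e : Fin φ.rank → φ.Points, (∀ i, l • e i = 0) ∧
      (∀ a : Fin φ.rank → F[X], ∑ i, a i • e i = 0 → ∀ i, l ∣ a i) ∧
      ∀ x : φ.Points, l • x = 0 → ∃ a : Fin φ.rank → F[X], x = ∑ i, a i • e i := by
  have hmax : (Ideal.span {l}).IsMaximal := PrincipalIdealRing.isMaximal_of_irreducible hl
  let : Field (F[X] ⧸ Ideal.span {l}) := Ideal.Quotient.field _
  let N := Submodule.torsionBy F[X] φ.Points l
  have hcardN : Nat.card N = Fintype.card F ^ (φ.rank * l.natDegree) :=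
    φ.card_torsion hl.ne_zero h
  have hq : 1 < Fintype.card F := Fintype.one_lt_card
  have hfinN : Finite N := Nat.finite_of_card_ne_zero (by rw [hcardN]; positivity)
  have hfinF : Module.Finite F (F[X] ⧸ Ideal.span {l}) :=
    (AdjoinRoot.powerBasis hl.ne_zero).finite
  have hcardK : Nat.card (F[X] ⧸ Ideal.span {l}) = Fintype.card F ^ l.natDegree := by
    rw [Module.natCard_eq_pow_finrank (K := F), finrank_quotient_span_eq_natDegree,
      Nat.card_eq_fintype_card]
  have hrank : Module.finrank (F[X] ⧸ Ideal.span {l}) N = φ.rank := by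
    have h1 := Module.natCard_eq_pow_finrank (K := F[X] ⧸ Ideal.span {l}) (V := N)
    rw [hcardN, hcardK, ← pow_mul, mul_comm] at h1
    exact (Nat.eq_of_mul_eq_mul_left hl.natDegree_pos (Nat.pow_right_injective hq h1)).symm
  let b := Module.finBasisOfFinrankEq (F[X] ⧸ Ideal.span {l}) N hrank
  refine ⟨fun i => (b i).1, fun i => (b i).2, fun a ha i => ?_, fun x hx => ?_⟩
  · have h1 : ∑ i, Ideal.Quotient.mk (Ideal.span {l}) (a i) • b i = 0 := by
      refine Subtype.ext ?_
      rw [AddSubmonoidClass.coe_finsetSum]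
      exact ha
    have h2 := Fintype.linearIndependent_iff.1 b.linearIndependent _ h1 i
    rwa [Ideal.Quotient.eq_zero_iff_mem, Ideal.mem_span_singleton] at h2
  · choose a ha using fun i => Ideal.Quotient.mk_surjective (b.repr ⟨x, hx⟩ i)
    refine ⟨a, ?_⟩
    have h1 := congrArg Subtype.val (b.sum_repr ⟨x, hx⟩)
    rw [AddSubmonoidClass.coe_finsetSum] at h1
    refine h1.symm.trans (Finset.sum_congr rfl fun i _ => ?_)
    rw [← ha]
    rfl

theorem exists_tateBasis [Finite k] {l : F[X]} (hm : l.Monic) (hl : Irreducible l)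
    (hne : l ≠ φ.characteristic) :
    ∃ b : Module.Basis (Fin φ.rank) (Completion l) (φ.Tate l), ∀ n, ∀ x : φ.Points,
      l ^ n • x = 0 → ∃ a : Fin φ.rank → F[X], x = ∑ i, a i • (b i).1 n := by
  obtain ⟨e, he, hind, hspan⟩ := φ.exists_torsion_basis hl (φ.cf_toAlgHom_zero_ne_zero hm hl hne)
  refine exists_tate_basis (fun x => action_surjective (u := φ.toAlgHom l) ?_ x) he hind hspan
  intro h
  exact hl.ne_zero (φ.injective (h.trans (map_zero φ.toAlgHom).symm))

theorem nontrivial_completion {l : F[X]} (hl : Irreducible l) : Nontrivial (Completion l) := by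
  have : Nontrivial (F[X] ⧸ Ideal.span {l} ^ 1) := by
    rw [pow_one]
    exact Ideal.Quotient.nontrivial_iff.2 fun h => hl.not_isUnit (Ideal.span_singleton_eq_top.1 h)
  exact (AdicCompletion.evalₐ (Ideal.span {l}) 1).toRingHom.domain_nontrivial

/-- The determinant of `v` on the Tate module at `l` modulo `l ^ n`, compared with its determinant
on `k{τ}`. -/
theorem exists_eval_det_tateEnd [Finite k] {l : F[X]} (hm : l.Monic) (hl : Irreducible l)
    (hne : l ≠ φ.characteristic) (v : φ.End) {V : Matrix (Fin φ.rank) (Fin φ.rank) k[X]}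
    (hV : ∀ i : Fin φ.rank, SkewPolynomial.X ^ (i : ℕ) * (v : TwistedPoly F k) =
      ∑ j, (V i j).sum (fun t c => cst c * bas (φ.toAlgHom X) j t)) {n : ℕ} (hn : n ≠ 0) :
    ∃ a : F[X], AdicCompletion.evalₐ (Ideal.span {l}) n (LinearMap.det (φ.tateEnd l v)) =
        Ideal.Quotient.mk _ a ∧
      (l ^ n).map (algebraMap F (AlgebraicClosure k)) ∣
        V.det.map (algebraMap k (AlgebraicClosure k)) -
          a.map (algebraMap F (AlgebraicClosure k)) := by
  obtain ⟨b, hb⟩ := φ.exists_tateBasis hm hl hne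
  let D := LinearMap.toMatrix b b (φ.tateEnd l v)
  -- Lifting the entries modulo `l ^ n` gives a matrix of `v` on the `l ^ n`-torsion, in terms of
  -- the level `n` components of the basis.
  let a : Matrix (Fin φ.rank) (Fin φ.rank) F[X] := Matrix.of fun h j => rep (D h j) n
  have hcf : cf (φ.toAlgHom (l ^ n)) 0 ≠ 0 := by
    rw [cf_toAlgHom_zero, map_pow, ← cf_toAlgHom_zero]
    exact pow_ne_zero n (φ.cf_toAlgHom_zero_ne_zero hm hl hne)
  refine ⟨a.det, ?_, ?_⟩
  · rw [← LinearMap.det_toMatrix b]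
    have h1 : (AdicCompletion.evalₐ (Ideal.span {l}) n).toRingHom.mapMatrix D =
        (Ideal.Quotient.mk (Ideal.span {l} ^ n)).mapMatrix a := by
      ext i j
      exact (mk_rep (D i j) n).symm
    have h2 := congrArg Matrix.det h1
    rw [← RingHom.map_det, ← RingHom.map_det] at h2
    exact h2
  · refine φ.mk_det_eq (hm.pow n) ?_ φ.degτ_toAlgHom_X
      (φ.card_torsion (pow_ne_zero n hl.ne_zero) hcf) (fun j => ((b j).2 n).1) (hb n) v hV ?_
    · rw [natDegree_pow]
      exact mul_ne_zero hn hl.natDegree_pos.ne'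
    · intro j
      have h1 : φ.tateEnd l v (b j) = ∑ h, D h j • b h := by
        rw [← b.sum_repr (φ.tateEnd l v (b j))]
        exact Finset.sum_congr rfl fun h _ =>
          congrArg (· • b h) (LinearMap.toMatrix_apply b b (φ.tateEnd l v) h j).symm
      have h2 := congrArg (fun s : φ.Tate l => s.1 n) h1
      rw [tateModule_sum_apply] at h2
      exact h2

theorem exists_irreducible_ne (p : F[X]) : ∃ l : F[X], l.Monic ∧ Irreducible l ∧ l ≠ p := by
  by_cases h : X - C (0 : F) = p
  · refine ⟨X - C 1, monic_X_sub_C 1, irreducible_X_sub_C 1, ?_⟩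
    rw [← h]
    intro h'
    exact one_ne_zero (C_injective (sub_right_injective h'))
  · exact ⟨X - C 0, monic_X_sub_C 0, irreducible_X_sub_C 0, h⟩

/-- The determinant of an endomorphism on the Tate modules is a polynomial, which does not depend on
the prime and has the degree of the endomorphism. -/
theorem exists_det [Finite k] (v : φ.End) : ∃ d : F[X],
    (∀ l : F[X], l.Monic → Irreducible l → l ≠ φ.characteristic →
      LinearMap.det (φ.tateEnd l v) = algebraMap F[X] (Completion l) d) ∧
    d.degree = degτ (v : TwistedPoly F k) := by
  obtain ⟨V, hV, hdeg⟩ := exists_motive_matrix φ.rank_pos φ.degτ_toAlgHom_X (v : TwistedPoly F k)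
  have hFL : algebraMap F (AlgebraicClosure k) =
      (algebraMap k (AlgebraicClosure k)).comp (algebraMap F k) :=
    IsScalarTower.algebraMap_eq F k (AlgebraicClosure k)
  obtain ⟨d, hd⟩ : ∃ d : F[X], d.map (algebraMap F k) = V.det := by
    obtain ⟨l, hm, hl, hne⟩ := exists_irreducible_ne φ.characteristic
    -- This makes `deg (l ^ n)` exceed `deg (det V)`, so `det V` is its own remainder modulo `l ^ n`
    -- and equals that of `a`, which is defined over `F`.
    set n := V.det.natDegree + 1
    obtain ⟨a, -, ha⟩ := φ.exists_eval_det_tateEnd hm hl hne v hV (n := n) (Nat.succ_ne_zero _)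
    have hmn : (l ^ n).Monic := hm.pow n
    have hln : (V.det).degree < (l ^ n).degree := by
      refine degree_le_natDegree.trans_lt ?_
      rw [degree_eq_natDegree hmn.ne_zero, natDegree_pow]
      refine WithBot.coe_lt_coe.2 ?_
      have := hl.natDegree_pos
      change V.det.natDegree < (V.det.natDegree + 1) * l.natDegree
      nlinarith
    refine ⟨a %ₘ l ^ n, map_injective _ (algebraMap k (AlgebraicClosure k)).injective ?_⟩
    rw [map_map, ← hFL, eq_comm, ← sub_eq_zero]
    refine eq_zero_of_dvd_of_degree_lt (p := (l ^ n).map (algebraMap F (AlgebraicClosure k))) ?_ ?_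
    · have h1 : (l ^ n).map (algebraMap F (AlgebraicClosure k)) ∣
          (a - a %ₘ l ^ n).map (algebraMap F (AlgebraicClosure k)) :=
        Polynomial.map_dvd _ (by
          rw [modByMonic_eq_sub_mul_div, sub_sub_cancel]
          exact Dvd.intro _ rfl)
      have h2 := dvd_add ha h1
      rwa [Polynomial.map_sub, sub_add_sub_cancel] at h2
    · refine (degree_sub_le _ _).trans_lt (max_lt ?_ ?_)
      · rwa [degree_map, degree_map]
      · rw [degree_map, degree_map]
        exact degree_modByMonic_lt _ hmn
  refine ⟨d, fun l hm hl hne => ?_, by rw [← hdeg, ← hd, degree_map]⟩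
  refine AdicCompletion.ext_evalₐ fun n => ?_
  rcases eq_or_ne n 0 with rfl | hn
  · have : Subsingleton (F[X] ⧸ Ideal.span {l} ^ 0) := by
      rw [pow_zero, Ideal.one_eq_top]
      exact Ideal.Quotient.subsingleton_iff.2 rfl
    exact Subsingleton.elim _ _
  · obtain ⟨a, ha1, ha2⟩ := φ.exists_eval_det_tateEnd hm hl hne v hV hn
    rw [ha1, AlgHom.commutes, Ideal.Quotient.algebraMap_eq, Ideal.Quotient.eq,
      Ideal.span_singleton_pow, Ideal.mem_span_singleton, ← neg_sub, dvd_neg]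
    -- Divisibility descends from the algebraic closure to `F`.
    rwa [← hd, map_map, ← hFL, ← Polynomial.map_sub, Polynomial.map_dvd_map'] at ha2

end DrinfeldModule

/-! ### The valuation and its extension to the fraction field. -/

section Valuation

/-- An additive valuation with values in `ℤ` that is finite away from `0` extends to the field of
fractions. -/
theorem AddValuation.exists_extend_fractionRing {R : Type*} [CommRing R] [IsDomain R]
    (w₀ : AddValuation R (WithTop ℤ)) (h : ∀ x, x ≠ 0 → w₀ x ≠ ⊤) :
    ∃ w : AddValuation (FractionRing R) (WithTop ℤ),
      w.comap (algebraMap R (FractionRing R)) = w₀ := by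
  let v₀ : Valuation R (Multiplicative (WithTop ℤ)ᵒᵈ) := AddValuation.toValuation w₀
  -- Finiteness away from `0` puts every nonzero element outside the support, which is what
  -- extension to the localization requires.
  have hS : nonZeroDivisors R ≤ v₀.supp.primeCompl := fun x hx hx' =>
    h x (nonZeroDivisors.ne_zero hx) hx'
  refine ⟨AddValuation.ofValuation (v₀.extendToLocalization hS (FractionRing R)), ?_⟩
  ext x
  exact v₀.extendToLocalization_apply_map_apply hS (FractionRing R) x

variable {F : Type*} [Field F]

theorem negDeg_eq_top {a : F[X]} : negDeg a = ⊤ ↔ a = 0 := by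
  unfold negDeg
  split_ifs with h <;> simp [h]

theorem negDeg_of_degree_eq {a : F[X]} {n : ℕ} (h : a.degree = n) :
    negDeg a = ((-(n : ℤ) : ℤ) : WithTop ℤ) := by
  have h0 : a ≠ 0 := fun h0 => by rw [h0, degree_zero] at h; exact WithBot.bot_ne_coe h
  rw [negDeg, if_neg h0, natDegree_eq_of_degree_eq_some h]

theorem negDeg_le_of_degree_le {a b : F[X]} (h : a.degree ≤ b.degree) : negDeg b ≤ negDeg a := by
  rcases eq_or_ne a 0 with rfl | ha
  · rw [negDeg_eq_top.2 rfl]; exact le_top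
  · have hb : b ≠ 0 := fun hb => by
      rw [hb, degree_zero, le_bot_iff, degree_eq_bot] at h; exact ha h
    rw [negDeg, negDeg, if_neg ha, if_neg hb]
    exact WithTop.coe_le_coe.2 (neg_le_neg (Int.ofNat_le.2 (natDegree_le_natDegree h)))

theorem negDeg_eq_of_degree_eq {a b : F[X]} (h : a.degree = b.degree) : negDeg a = negDeg b :=
  le_antisymm (negDeg_le_of_degree_le h.ge) (negDeg_le_of_degree_le h.le)

theorem negDeg_mul (a b : F[X]) : negDeg (a * b) = negDeg a + negDeg b := by
  rcases eq_or_ne a 0 with rfl | ha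
  · rw [zero_mul, negDeg_eq_top.2 rfl, top_add]
  rcases eq_or_ne b 0 with rfl | hb
  · rw [mul_zero, negDeg_eq_top.2 rfl, add_top]
  rw [negDeg, negDeg, negDeg, if_neg ha, if_neg hb, if_neg (mul_ne_zero ha hb),
    natDegree_mul ha hb, ← WithTop.coe_add]
  congr 1
  push_cast
  ring

end Valuation

namespace DrinfeldModule

variable {F k : Type*} [Field F] [Fintype F] [Field k] [Algebra F k] (φ : DrinfeldModule F k)

theorem isDomain_adjoinT (v : φ.End) : IsDomain (φ.adjoinT v) := by
  have : NoZeroDivisors (φ.adjoinT v) := ⟨fun {a b} hab => by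
    have h : ((a : φ.End) : TwistedPoly F k) * ((b : φ.End) : TwistedPoly F k) = 0 :=
      congrArg (fun x : φ.adjoinT v => ((x : φ.End) : TwistedPoly F k)) hab
    exact (mul_eq_zero.1 h).imp (fun h => Subtype.ext (Subtype.ext h))
      fun h => Subtype.ext (Subtype.ext h)⟩
  have : Nontrivial (φ.adjoinT v) := ⟨⟨0, 1, fun h => zero_ne_one (α := TwistedPoly F k)
    (congrArg (fun x : φ.adjoinT v => ((x : φ.End) : TwistedPoly F k)) h)⟩⟩
  exact NoZeroDivisors.to_isDomain _

/-- A function to polynomials that preserves the degrees gives a valuation on `F[v, T]`. -/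
theorem exists_addValuation {det : φ.End → F[X]}
    (hdet : ∀ v : φ.End, (det v).degree = degτ (v : TwistedPoly F k)) (v : φ.End) :
    ∃ w₀ : AddValuation (φ.adjoinT v) (WithTop ℤ),
      (∀ x : φ.adjoinT v, w₀ x = negDeg (det (x : φ.End))) ∧
      IsDomain (φ.adjoinT v) ∧
      ∃ w : AddValuation (FractionRing (φ.adjoinT v)) (WithTop ℤ),
        w.comap (algebraMap (φ.adjoinT v) (FractionRing (φ.adjoinT v))) = w₀ := by
  have hdom := φ.isDomain_adjoinT v
  have hzero : ∀ x : φ.End, det x = 0 ↔ x = 0 := fun x => by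
    rw [← degree_eq_bot, hdet, degτ_eq_bot, ZeroMemClass.coe_eq_zero]
  -- Only the degree of `det` matters: the axioms are multiplicativity and the ultrametric
  -- inequality of `degτ`.
  let w₀ : AddValuation (φ.adjoinT v) (WithTop ℤ) :=
    AddValuation.of (fun x => negDeg (det (x : φ.End)))
      (negDeg_eq_top.2 ((hzero _).2 rfl))
      (negDeg_of_degree_eq (n := 0) ((hdet _).trans degτ_one))
      (fun x y => by
        have h : (det ((x + y : φ.adjoinT v) : φ.End)).degree ≤
            max (det (x : φ.End)).degree (det (y : φ.End)).degree := by
          rw [hdet, hdet, hdet]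
          exact degτ_add_le _ _
        rcases le_max_iff.1 h with h | h
        · exact (min_le_left _ _).trans (negDeg_le_of_degree_le h)
        · exact (min_le_right _ _).trans (negDeg_le_of_degree_le h))
      (fun x y => by
        rw [← negDeg_mul]
        refine negDeg_eq_of_degree_eq ?_
        rw [degree_mul, hdet, hdet, hdet]
        exact degτ_mul)
  refine ⟨w₀, fun x => rfl, hdom, w₀.exists_extend_fractionRing fun x hx h => hx ?_⟩
  exact Subtype.ext ((hzero _).1 (negDeg_eq_top.1 h))

end DrinfeldModule

end

theorem theorem3p6 {F k : Type*} [Field F] [Fintype F] [Field k] [Finite k] [Algebra F k]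
    (φ : DrinfeldModule F k) :
    -- away from the characteristic the Tate modules are free of rank `φ.rank`
    (∀ l : F[X], l.Monic → Irreducible l → l ≠ φ.characteristic →
      Module.Free (Drinfeld.Completion l) (φ.Tate l) ∧
      Module.Finite (Drinfeld.Completion l) (φ.Tate l) ∧
      Module.finrank (Drinfeld.Completion l) (φ.Tate l) = φ.rank) ∧
    -- the determinant on the Tate modules is a polynomial that does not depend on `l`
    ∃ det : φ.End → F[X],
      (∀ l : F[X], l.Monic → Irreducible l → l ≠ φ.characteristic → ∀ v : φ.End,
        LinearMap.det (φ.tateEnd l v) = algebraMap F[X] (Drinfeld.Completion l) (det v)) ∧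
      ∀ v : φ.End,
        (det v).degree = Drinfeld.degτ (v : Drinfeld.TwistedPoly F k) ∧
        ∃ w₀ : AddValuation (φ.adjoinT v) (WithTop ℤ),
          (∀ x : φ.adjoinT v, w₀ x = negDeg (det (x : φ.End))) ∧
          IsDomain (φ.adjoinT v) ∧
          ∃ w : AddValuation (FractionRing (φ.adjoinT v)) (WithTop ℤ),
            w.comap (algebraMap (φ.adjoinT v) (FractionRing (φ.adjoinT v))) = w₀ := by
  refine ⟨fun l hm hl hne => ?_, ?_⟩
  · obtain ⟨b, -⟩ := φ.exists_tateBasis hm hl hne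
    have := DrinfeldModule.nontrivial_completion hl
    refine ⟨Module.Free.of_basis b, Module.Finite.of_basis b, ?_⟩
    rw [Module.finrank_eq_card_basis b, Fintype.card_fin]
  · choose det hdet hdeg using φ.exists_det
    exact ⟨det, fun l hm hl hne v => hdet v l hm hl hne, fun v =>
      ⟨hdeg v, φ.exists_addValuation hdeg v⟩⟩
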